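/- For a sequence $(y_j)_{j\ge 0}$ in $[0,1)$ let $D_N((y_j)_{j\ge0})=\sup_{0\le u<v\le 1}\left|\frac{\#\{0\le j<N:\ u\le y_j<v\}}{N}-(v-u)\right|$ be the discrepancy of its first $N$ terms, and let $\{y\}=y-\lfloor y\rfloor$. There is an algorithm that computes the base-2 expansion of a real number $x\in[0,1)$ with the following properties. The number $x$ is absolutely normal, that is, for every integer $b\ge2$ every block of $k$ base-$b$ digits occurs in the base-$b$ expansion of $x$ with limiting frequency $b^{-k}$. For every integer $b\ge 2$, $$\limsup_{N\to\infty}\frac{D_N(\{b^jx\}_{j\ge0})\,\sqrt N}{\sqrt{\log\log N}}<3\,C_b,\qquad\text{where } C_b=166+\frac{664}{\sqrt b-1}.$$ The algorithm outputs the binary digits of $x$ one after the other, and there is a constant $c\in\mathbb N$ such that for every $n$ it has output the first $n$ digits after at most $2^{2^{2^{cn}}}$ elementary operations. Here an algorithm is a while-program, without input, over finitely many registers that hold natural numbers and are initially $0$; the elementary operations, each of unit cost, are loading a constant, addition, truncated subtraction, outputting the content of a register, testing a register for zero in a loop, and sequencing. -/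

import Mathlib

open Filter Topology

/-! ### Discrepancy and normality -/

/-- The discrepancy `D_N` of the first `N` terms `y 0, …, y (N - 1)` of a sequence of real numbers:
the supremum over `0 ≤ u < v ≤ 1` of `|#{j < N : u ≤ y j < v} / N - (v - u)|`.
For `N ≥ 1` this is the supremum of a nonempty set of reals that is bounded by `1`. -/
noncomputable def discrepancy (N : ℕ) (y : ℕ → ℝ) : ℝ :=
  sSup {d : ℝ | ∃ u v : ℝ, 0 ≤ u ∧ u < v ∧ v ≤ 1 ∧
    d = |(Nat.card {j : ℕ // j < N ∧ u ≤ y j ∧ y j < v} : ℝ) / N - (v - u)|}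

/-- Philipp's constant `C_b = 166 + 664 / (√b - 1)`. -/
noncomputable def philippConstant (b : ℕ) : ℝ :=
  166 + 664 / (Real.sqrt b - 1)

/-- `x` is normal to base `b`: every block `w` of `k` base-`b` digits occurs in the expansion of the
fractional part of `x` with limiting frequency `b ^ (-k)`. -/
def IsNormalToBase (b : ℕ) [NeZero b] (x : ℝ) : Prop :=
  ∀ (k : ℕ) (w : Fin k → Fin b),
    Tendsto (fun N : ℕ =>
      (Nat.card {j : ℕ // j < N ∧ ∀ i : Fin k, Real.digits (Int.fract x) b (j + i) = w i} : ℝ) / N)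
      atTop (𝓝 (1 / (b : ℝ) ^ k))

/-- `x` is absolutely normal: it is normal to every integer base `b ≥ 2`. -/
def IsAbsolutelyNormal (x : ℝ) : Prop :=
  ∀ (b : ℕ) [NeZero b], 2 ≤ b → IsNormalToBase b x

/-! ### A machine model with a step count

Programs act on registers `0, 1, 2, …` that hold natural numbers; each program mentions only
finitely many of them. The basic operations are loading a constant, addition, truncated subtraction,
and appending a number to the output; each of them, each loop test and each sequencing costs
one step. (Multiplication is deliberately not a basic operation, so that a single step lengthens a
number by at most one bit, up to the constants of the program.) -/

/-- Programs of the machine. -/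
inductive Prog : Type
  /-- register `r` becomes the constant `k` -/
  | const (r k : ℕ) : Prog
  /-- register `r` becomes the sum of the registers `s` and `t` -/
  | add (r s t : ℕ) : Prog
  /-- register `r` becomes the truncated difference of the registers `s` and `t` -/
  | sub (r s t : ℕ) : Prog
  /-- append the content of register `r` to the output -/
  | emit (r : ℕ) : Prog
  /-- first `p`, then `q` -/
  | seq (p q : Prog) : Prog
  /-- as long as register `r` is not zero, repeat `p` -/
  | loop (r : ℕ) (p : Prog) : Prog

/-- A configuration of the machine: the stack of the programs that are still to be run, the contents
of the registers, and the numbers output so far, in the order in which they were output. -/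
structure Config where
  todo : List Prog
  reg : ℕ → ℕ
  out : List ℕ

/-- One step of the machine. A configuration with nothing left to be run does not change. -/
def Config.step : Config → Config
  | ⟨[], g, o⟩ => ⟨[], g, o⟩
  | ⟨.const r k :: K, g, o⟩ => ⟨K, Function.update g r k, o⟩
  | ⟨.add r s t :: K, g, o⟩ => ⟨K, Function.update g r (g s + g t), o⟩
  | ⟨.sub r s t :: K, g, o⟩ => ⟨K, Function.update g r (g s - g t), o⟩
  | ⟨.emit r :: K, g, o⟩ => ⟨K, g, o ++ [g r]⟩
  | ⟨.seq p q :: K, g, o⟩ => ⟨p :: q :: K, g, o⟩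
  | ⟨.loop r p :: K, g, o⟩ => if g r = 0 then ⟨K, g, o⟩ else ⟨p :: .loop r p :: K, g, o⟩

/-- What the program `p`, started with all registers zero and empty output, has output after
`t` steps. -/
def Prog.outputAfter (p : Prog) (t : ℕ) : List ℕ :=
  (Config.step^[t] ⟨[p], fun _ => 0, []⟩).out

/-- The program `p` computes the base-`2` expansion of `x ∈ [0, 1)` within time `T`: it outputs the
digits after the binary point one after the other, and for every `n` there is a moment, after at
most `T n` steps, at which the output consists of exactly the first `n` digits. -/
def Prog.ComputesBinaryDigitsInTime (p : Prog) (x : ℝ) (T : ℕ → ℕ) : Prop :=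
  ∀ n : ℕ, ∃ t : ℕ, t ≤ T n ∧
    p.outputAfter t = (List.range n).map fun i => (Real.digits x 2 i : ℕ)

/-! The number is the limit of nested closed dyadic cells. Stage k replaces a cell of length
2^(-4^k) by its first subcell of length 2^(-4^(k+1)) that passes finitely many tests (`StageGood`).
Write l for the integer part of log₂ log₂ k. For each active base b the tests demand that the whole
closed subcell shares its base-b digits almost to the end. They also demand that, among the new
digits, the count of each block of length h ≤ k along each residue class mod h misses its
expectation by at most l·2^k/h³, uniformly over initial segments.

A good subcell exists by counting. Over the subcells of a cell, the new base-b digits behave like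
independent uniform digits up to a factor 6 (`equidistribution`). A fourth moment bound, Doob's
maximal inequality and Markov's inequality bound the failures of a single test
(`deviation_count_le`), and summing over all tests leaves a bad fraction O(1/l) + 2/2^k per base
(`card_not_cellGood_le`). Base b is active only if K·b ≤ l, so there are at most l/K active bases,
and a large constant K keeps the total below 1 (`exists_stageGood`). Each stage chooses afresh
inside the cell already chosen, so failure probabilities need not be summable over the stages. This
is why the limit can do better than the law of the iterated logarithm for random numbers.

Adding the h residue classes leaves an error l·2^k/h² for blocks of length h. This is summable in h,
so intervals with b-adic endpoints, and then all intervals, have error O(b·l·2^k) within stage k.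
The errors of the stages add up geometrically, and stage k is reached after at least 4^k/b digits,
so N·D_N is O(l·√N) for fixed b (`IsLimit.abs_starDev_le`). Since log log N ≥ 2^l/4, this is
eventually below √(N log log N): the upper limit is at most 1, far below 3·C_b. Normality follows
because D_N tends to 0.

All numbers needed for digit n are polynomially bounded in `powBound n`, and exhaustive search takes
time polynomial in this bound. The calculus `Comp` proves this by closure properties. Powers are
capped so that recursions keep polynomially bounded values, and the cap is chosen so large that it
never acts. -/

/-! ### Running programs -/

/-- `p` turns the registers `g` into `g'` in exactly `t` steps, without output. -/
def Prog.Runs (p : Prog) (g g' : ℕ → ℕ) (t : ℕ) : Prop :=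
  ∀ K o, Config.step^[t] ⟨p :: K, g, o⟩ = ⟨K, g', o⟩

namespace Prog.Runs

theorem const (r k : ℕ) (g : ℕ → ℕ) : (Prog.const r k).Runs g (Function.update g r k) 1 :=
  fun _ _ => rfl

theorem add (r s t : ℕ) (g : ℕ → ℕ) :
    (Prog.add r s t).Runs g (Function.update g r (g s + g t)) 1 :=
  fun _ _ => rfl

theorem sub (r s t : ℕ) (g : ℕ → ℕ) :
    (Prog.sub r s t).Runs g (Function.update g r (g s - g t)) 1 :=
  fun _ _ => rfl

theorem seq {p q : Prog} {g g₁ g₂ : ℕ → ℕ} {t₁ t₂ : ℕ} (h₁ : p.Runs g g₁ t₁)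
    (h₂ : q.Runs g₁ g₂ t₂) : (Prog.seq p q).Runs g g₂ (t₂ + (t₁ + 1)) := by
  intro K o
  rw [Function.iterate_add_apply, Function.iterate_add_apply, Function.iterate_one]
  change Config.step^[t₂] (Config.step^[t₁] ⟨p :: q :: K, g, o⟩) = _
  rw [h₁, h₂]

theorem loop_zero {r : ℕ} (p : Prog) {g : ℕ → ℕ} (h : g r = 0) : (Prog.loop r p).Runs g g 1 := by
  intro K o
  simp [Config.step, h]

theorem loop_succ {r : ℕ} {p : Prog} {g g₁ g₂ : ℕ → ℕ} {t₁ t₂ : ℕ} (h : g r ≠ 0)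
    (h₁ : p.Runs g g₁ t₁) (h₂ : (Prog.loop r p).Runs g₁ g₂ t₂) :
    (Prog.loop r p).Runs g g₂ (t₂ + (t₁ + 1)) := by
  intro K o
  rw [Function.iterate_add_apply, Function.iterate_add_apply, Function.iterate_one]
  have : Config.step ⟨Prog.loop r p :: K, g, o⟩ = ⟨p :: Prog.loop r p :: K, g, o⟩ := by
    simp [Config.step, h]
  rw [this, h₁, h₂]

/-- A counting loop with an invariant. -/
theorem loop_of_invariant {r n T : ℕ} {p : Prog} (Inv : ℕ → (ℕ → ℕ) → Prop)
    (hr : ∀ j g, Inv j g → g r = n - j)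
    (hp : ∀ j < n, ∀ g, Inv j g → ∃ t ≤ T, ∃ g', p.Runs g g' t ∧ Inv (j + 1) g')
    {g : ℕ → ℕ} (hg : Inv 0 g) :
    ∃ t ≤ n * (T + 1) + 1, ∃ g', (Prog.loop r p).Runs g g' t ∧ Inv n g' := by
  suffices H : ∀ d j, j + d = n → ∀ g, Inv j g →
      ∃ t ≤ d * (T + 1) + 1, ∃ g', (Prog.loop r p).Runs g g' t ∧ Inv n g' from
    H n 0 (by omega) g hg
  intro d
  induction d with
  | zero =>
    intro j hj g hg
    refine ⟨1, by omega, g, loop_zero p ?_, ?_⟩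
    · rw [hr j g hg]; omega
    · rwa [show n = j by omega]
  | succ d ih =>
    intro j hj g hg
    obtain ⟨t₁, ht₁, g₁, hrun, hinv⟩ := hp j (by omega) g hg
    obtain ⟨t₂, ht₂, g₂, hrun₂, hinv₂⟩ := ih (j + 1) (by omega) g₁ hinv
    refine ⟨t₂ + (t₁ + 1), ?_, g₂, loop_succ ?_ hrun hrun₂, hinv₂⟩
    · rw [add_mul]; omega
    · rw [hr j g hg]; omega

end Prog.Runs

/-! ### Polynomial bounds -/

/-- `f` is bounded by a power of `m`. -/
def PolyBdd {α : Type*} (m f : α → ℕ) : Prop := ∃ c, ∀ a, f a ≤ m a ^ c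

namespace PolyBdd

variable {α β : Type*} {m f f₁ f₂ : α → ℕ}

theorem mono (h : PolyBdd m f₂) (hf : ∀ a, f₁ a ≤ f₂ a) : PolyBdd m f₁ :=
  h.imp fun _ hc a => (hf a).trans (hc a)

theorem self : PolyBdd m m := ⟨1, fun a => by simp⟩

/-- The exponent k itself serves, because k < 2^k. This is why sizes are kept at least 2. -/
theorem const (hm : ∀ a, 2 ≤ m a) (k : ℕ) : PolyBdd m fun _ => k :=
  ⟨k, fun a => (Nat.lt_two_pow_self).le.trans (Nat.pow_le_pow_left (hm a) k)⟩

theorem mul (h₁ : PolyBdd m f₁) (h₂ : PolyBdd m f₂) : PolyBdd m fun a => f₁ a * f₂ a := by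
  obtain ⟨c₁, h₁⟩ := h₁
  obtain ⟨c₂, h₂⟩ := h₂
  exact ⟨c₁ + c₂, fun a => by rw [pow_add]; exact Nat.mul_le_mul (h₁ a) (h₂ a)⟩

theorem add (hm : ∀ a, 2 ≤ m a) (h₁ : PolyBdd m f₁) (h₂ : PolyBdd m f₂) :
    PolyBdd m fun a => f₁ a + f₂ a := by
  obtain ⟨c₁, h₁⟩ := h₁
  obtain ⟨c₂, h₂⟩ := h₂
  refine ⟨c₁ + c₂ + 1, fun a => ?_⟩
  have h0 : 0 < m a := by have := hm a; omega
  have e₁ : m a ^ c₁ ≤ m a ^ (c₁ + c₂) := Nat.pow_le_pow_right h0 (by omega)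
  have e₂ : m a ^ c₂ ≤ m a ^ (c₁ + c₂) := Nat.pow_le_pow_right h0 (by omega)
  calc f₁ a + f₂ a ≤ m a ^ (c₁ + c₂) * 2 := by have := h₁ a; have := h₂ a; omega
    _ ≤ m a ^ (c₁ + c₂ + 1) := by rw [pow_succ]; exact Nat.mul_le_mul_left _ (hm a)

theorem pow (h : PolyBdd m f) (k : ℕ) : PolyBdd m fun a => f a ^ k := by
  obtain ⟨c, h⟩ := h
  exact ⟨c * k, fun a => by rw [pow_mul]; exact Nat.pow_le_pow_left (h a) k⟩

end PolyBdd

/-! ### Functions of the registers that are computed in polynomial time -/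

/-- The size of the contents of the registers below `e`. -/
def regSize (e : ℕ) (g : ℕ → ℕ) : ℕ := 2 + ∑ i ∈ Finset.range e, g i

theorem two_le_regSize (e : ℕ) (g : ℕ → ℕ) : 2 ≤ regSize e g := Nat.le_add_right _ _

theorem regSize_succ (e : ℕ) (g : ℕ → ℕ) : regSize (e + 1) g = regSize e g + g e := by
  simp [regSize, Finset.sum_range_succ, add_assoc]

theorem regSize_congr {e : ℕ} {g g' : ℕ → ℕ} (h : ∀ i < e, g i = g' i) :
    regSize e g = regSize e g' := by
  unfold regSize
  rw [Finset.sum_congr rfl fun i hi => h i (Finset.mem_range.1 hi)]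

theorem regSize_mono {e e' : ℕ} (h : e ≤ e') (g : ℕ → ℕ) : regSize e g ≤ regSize e' g :=
  Nat.add_le_add_left (Finset.sum_le_sum_of_subset (Finset.range_mono h)) 2

theorem le_regSize {e i : ℕ} (h : i < e) (g : ℕ → ℕ) : g i ≤ regSize e g :=
  (Finset.single_le_sum (f := g) (fun _ _ => Nat.zero_le _) (Finset.mem_range.2 h)).trans
    (Nat.le_add_left _ _)

/-- `F` depends on the registers below `e` only, and for every `e' ≥ e` there is a program that puts
its value into register `e'` and preserves the registers below `e'`; the value and the running time
are polynomially bounded. -/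
structure Comp (e : ℕ) (F : (ℕ → ℕ) → ℕ) : Prop where
  congr : ∀ g g', (∀ i < e, g i = g' i) → F g = F g'
  bdd : PolyBdd (regSize e) F
  prog : ∀ e' ≥ e, ∃ (p : Prog) (T : (ℕ → ℕ) → ℕ), PolyBdd (regSize e') T ∧
    ∀ g, ∃ t ≤ T g, ∃ g', p.Runs g g' t ∧ (∀ i < e', g' i = g i) ∧ g' e' = F g

namespace Comp

variable {e : ℕ} {F G : (ℕ → ℕ) → ℕ}

theorem mono {e' : ℕ} (h : Comp e F) (he : e ≤ e') : Comp e' F where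
  congr g g' hg := h.congr g g' fun i hi => hg i (hi.trans_le he)
  bdd := by
    obtain ⟨c, hc⟩ := h.bdd
    exact ⟨c, fun g => (hc g).trans (Nat.pow_le_pow_left (regSize_mono he g) c)⟩
  prog e'' he'' := h.prog e'' (he.trans he'')

theorem const (e k : ℕ) : Comp e fun _ => k where
  congr _ _ _ := rfl
  bdd := PolyBdd.const (two_le_regSize e) k
  prog e' _ := ⟨Prog.const e' k, fun _ => 1, PolyBdd.const (two_le_regSize e') 1, fun g =>
    ⟨1, le_rfl, _, Prog.Runs.const e' k g, fun i hi => by simp [hi.ne], by simp⟩⟩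

theorem reg {v : ℕ} (hv : v < e) : Comp e fun g => g v where
  congr _ _ h := h v hv
  bdd := PolyBdd.self.mono fun g => le_regSize hv g
  -- There is no copy instruction; a copy is an addition to zero.
  prog e' he' := ⟨.seq (.const e' 0) (.add e' v e'), fun _ => 3,
    PolyBdd.const (two_le_regSize e') 3, fun g =>
    ⟨_, le_rfl, _, (Prog.Runs.const e' 0 g).seq (Prog.Runs.add e' v e' _),
      fun i hi => by simp [hi.ne], by simp [(hv.trans_le he').ne]⟩⟩

theorem bdd' {e' : ℕ} (h : Comp e F) (he : e ≤ e') : PolyBdd (regSize e') F := (h.mono he).bdd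

/-- Binary operations given by a single instruction. -/
theorem binary (op : ℕ → ℕ → ℕ) (hop : ∀ x y, op x y ≤ x + y) (P : ℕ → ℕ → ℕ → Prog)
    (hP : ∀ r s t g, (P r s t).Runs g (Function.update g r (op (g s) (g t))) 1)
    (hF : Comp e F) (hG : Comp e G) : Comp e fun g => op (F g) (G g) where
  congr g g' h := by rw [hF.congr g g' h, hG.congr g g' h]
  bdd := (hF.bdd.add (two_le_regSize e) hG.bdd).mono fun g => hop _ _
  prog e' he' := by
    obtain ⟨p, T, hT, hp⟩ := hF.prog e' he'
    -- The second program works above register e', which keeps the first value.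
    obtain ⟨q, U, ⟨c, hU⟩, hq⟩ := hG.prog (e' + 1) (by omega)
    have h2 := two_le_regSize e'
    refine ⟨.seq p (.seq q (P e' e' (e' + 1))), fun g => 3 + (T g + (regSize e' g + F g) ^ c),
      (PolyBdd.const h2 3).add h2 (hT.add h2 ((PolyBdd.self.add h2 (hF.bdd' he')).pow c)),
      fun g => ?_⟩
    obtain ⟨t₁, ht₁, g₁, hr₁, hk₁, hv₁⟩ := hp g
    obtain ⟨t₂, ht₂, g₂, hr₂, hk₂, hv₂⟩ := hq g₁
    refine ⟨_, ?_, _, hr₁.seq (hr₂.seq (hP e' e' (e' + 1) g₂)), fun i hi => ?_, ?_⟩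
    · have := hU g₁
      rw [regSize_succ, hv₁, regSize_congr hk₁] at this
      beta_reduce
      omega
    · rw [Function.update_of_ne hi.ne, hk₂ i (by omega), hk₁ i hi]
    · rw [Function.update_self, hk₂ e' (by omega), hv₁, hv₂,
        hG.congr g₁ g fun i hi => hk₁ i (by omega)]

theorem add (hF : Comp e F) (hG : Comp e G) : Comp e fun g => F g + G g :=
  binary (· + ·) (fun _ _ => le_rfl) Prog.add Prog.Runs.add hF hG

theorem sub (hF : Comp e F) (hG : Comp e G) : Comp e fun g => F g - G g :=
  binary (· - ·) (fun _ _ => (Nat.sub_le _ _).trans (Nat.le_add_right _ _)) Prog.sub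
    Prog.Runs.sub hF hG

/-- Recursion with polynomially bounded values. -/
theorem natRec {N A : (ℕ → ℕ) → ℕ} {S : ℕ → ℕ → (ℕ → ℕ) → ℕ} (hN : Comp e N) (hA : Comp e A)
    (hS : ∀ e' ≥ e, ∀ I X, Comp e' I → Comp e' X → Comp e' fun g => S (I g) (X g) g)
    (B : (ℕ → ℕ) → ℕ) (hB : PolyBdd (regSize e) B)
    (hR : ∀ g, ∀ j ≤ N g, (Nat.rec (A g) (fun i x => S i x g) j : ℕ) ≤ B g) :
    Comp e fun g => Nat.rec (A g) (fun i x => S i x g) (N g) where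
  congr g g' h := by
    have hs : (fun i x => S i x g) = fun i x => S i x g' := by
      funext i x
      exact (hS e le_rfl _ _ (const e i) (const e x)).congr g g' h
    simp only [hN.congr g g' h, hA.congr g g' h, hs]
  bdd := hB.mono fun g => hR g _ le_rfl
  prog e' he' := by
    obtain ⟨p, T, hT, hp⟩ := hA.prog e' he'
    obtain ⟨q, U, ⟨c, hU⟩, hq⟩ := hN.prog (e' + 1) (by omega)
    obtain ⟨w, W, ⟨d, hW⟩, hw⟩ := (hS (e' + 3) (by omega) _ _ (reg (v := e' + 2) (by omega))
      (reg (v := e') (by omega))).prog (e' + 3) le_rfl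
    -- Register e' holds the accumulator, e' + 1 the number of rounds left, e' + 2 the index, e' + 3
    -- the new value; e' + 4 is scratch.
    set body : Prog := .seq w (.seq (.const (e' + 4) 0) (.seq (.add e' (e' + 3) (e' + 4))
      (.seq (.const (e' + 4) 1) (.seq (.add (e' + 2) (e' + 2) (e' + 4))
        (.sub (e' + 1) (e' + 1) (e' + 4)))))) with hbody
    have h2 := two_le_regSize e'
    have hB' : PolyBdd (regSize e') B := by
      obtain ⟨k, hk⟩ := hB
      exact ⟨k, fun g => (hk g).trans (Nat.pow_le_pow_left (regSize_mono he' g) k)⟩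
    have hN' := hN.bdd' he'
    have hA' := hA.bdd' he'
    have hsum := ((PolyBdd.self.add h2 hB').add h2 hN')
    refine ⟨.seq p (.seq q (.seq (.const (e' + 2) 0) (.loop (e' + 1) body))),
      fun g => (10 + T g + (regSize e' g + A g) ^ c) +
        N g * ((regSize e' g + B g + N g) ^ d + 11), ?_, fun g => ?_⟩
    · exact (((PolyBdd.const h2 10).add h2 hT).add h2 ((PolyBdd.self.add h2 hA').pow c)).add h2
        (hN'.mul ((hsum.pow d).add h2 (PolyBdd.const h2 11)))
    obtain ⟨t₁, ht₁, g₁, hr₁, hk₁, hv₁⟩ := hp g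
    obtain ⟨t₂, ht₂, g₂, hr₂, hk₂, hv₂⟩ := hq g₁
    have hNg : N g₁ = N g := hN.congr _ _ fun i hi => hk₁ i (by omega)
    have hUt := hU g₁
    rw [regSize_succ, hv₁, regSize_congr hk₁] at hUt
    let Inv : ℕ → (ℕ → ℕ) → Prop := fun j f => (∀ i < e', f i = g i) ∧
      f e' = Nat.rec (A g) (fun i x => S i x g) j ∧ f (e' + 1) = N g - j ∧ f (e' + 2) = j
    obtain ⟨t₃, ht₃, g₃, hr₃, hi₃⟩ := Prog.Runs.loop_of_invariant (r := e' + 1) (n := N g)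
      (T := (regSize e' g + B g + N g) ^ d + 10) (p := body) Inv (fun j f hf => hf.2.2.1)
      (fun j hj f hf => by
        obtain ⟨hf₁, hf₂, hf₃, hf₄⟩ := hf
        obtain ⟨t, ht, f', hr, hk, hv⟩ := hw f
        have hsz : regSize (e' + 3) f ≤ regSize e' g + B g + N g := by
          have := hR g j hj.le
          rw [regSize_succ, regSize_succ, regSize_succ, regSize_congr hf₁, hf₂, hf₃, hf₄]
          omega
        have hWt := (hW f).trans (Nat.pow_le_pow_left hsz d)
        have hval : f' (e' + 3) = Nat.rec (A g) (fun i x => S i x g) (j + 1) := by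
          rw [hv, hf₂, hf₄]
          exact (hS e le_rfl _ _ (const e j) (const e _)).congr f g fun i hi => hf₁ i (by omega)
        refine ⟨_, ?_, _, hr.seq ((Prog.Runs.const _ _ _).seq ((Prog.Runs.add _ _ _ _).seq
          ((Prog.Runs.const _ _ _).seq ((Prog.Runs.add _ _ _ _).seq
            (Prog.Runs.sub _ _ _ _))))), ?_, ?_, ?_, ?_⟩
        · omega
        · intro i hi
          have h1 : i ≠ e' + 1 := by omega
          have h2 : i ≠ e' + 2 := by omega
          have h4 : i ≠ e' + 4 := by omega
          simp only [Function.update_of_ne h1, Function.update_of_ne h2, Function.update_of_ne h4,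
            Function.update_of_ne hi.ne]
          rw [hk i (by omega), hf₁ i hi]
        · simpa [Function.update_apply] using hval
        · simp
          rw [hk _ (by omega), hf₃]
          omega
        · simp
          rw [hk _ (by omega), hf₄])
      (g := Function.update g₂ (e' + 2) 0)
      ⟨fun i hi => by
          rw [Function.update_of_ne (by omega), hk₂ i (by omega), hk₁ i hi],
        by rw [Function.update_of_ne (by omega), hk₂ e' (by omega), hv₁]; rfl,
        by rw [Function.update_of_ne (by omega), hv₂, hNg, Nat.sub_zero], by simp⟩
    refine ⟨_, ?_, _, hr₁.seq (hr₂.seq ((Prog.Runs.const _ _ _).seq hr₃)), hi₃.1, hi₃.2.1⟩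
    have : N g * ((regSize e' g + B g + N g) ^ d + 10 + 1) =
      N g * ((regSize e' g + B g + N g) ^ d + 11) := rfl
    beta_reduce
    omega

end Comp

open Classical in
/-- The indicator of a proposition. -/
noncomputable def ind (P : Prop) : ℕ := if P then 1 else 0

theorem ind_true {P : Prop} (h : P) : ind P = 1 := if_pos h

theorem ind_false {P : Prop} (h : ¬P) : ind P = 0 := if_neg h

theorem card_filter_eq_sum_ind {α : Type*} (s : Finset α) (P : α → Prop) [DecidablePred P] :
    (s.filter P).card = ∑ i ∈ s, ind (P i) := by
  rw [Finset.card_filter]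
  refine Finset.sum_congr rfl fun i _ => ?_
  by_cases h : P i <;> simp [h, ind]

/-- Powers, capped at `V`. -/
def cappedPow (V b e : ℕ) : ℕ := Nat.rec 1 (fun _ x => min (x * b) V) e

theorem cappedPow_eq {V b : ℕ} (hb : 1 ≤ b) {e : ℕ} (h : b ^ e ≤ V) : cappedPow V b e = b ^ e := by
  induction e with
  | zero => rfl
  | succ e ih =>
    have := ih ((Nat.pow_le_pow_right hb (Nat.le_succ e)).trans h)
    change min (cappedPow V b e * b) V = _
    rw [this, ← pow_succ, min_eq_left h]

/-- The number of `i < R` with `p (i + 1) ≤ M`. For `p = (b ^ ·)` this is a logarithm. -/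
def logCount (p : ℕ → ℕ) (M R : ℕ) : ℕ := ((Finset.range R).filter fun i => p (i + 1) ≤ M).card

/-- The least `i < N` with `P i`, or `N` if there is none. -/
noncomputable def firstIndex (P : ℕ → Prop) (N : ℕ) : ℕ :=
  ∑ i ∈ Finset.range N, ind (∀ j < i + 1, ¬P j)

theorem firstIndex_spec {P : ℕ → Prop} {N : ℕ} (h : ∃ i < N, P i) :
    firstIndex P N < N ∧ P (firstIndex P N) := by
  classical
  obtain ⟨n, hn, hP⟩ := h
  have hex : ∃ i, P i := ⟨n, hP⟩
  have hlt : Nat.find hex < N := (Nat.find_min' hex hP).trans_lt hn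
  have : firstIndex P N = Nat.find hex := by
    unfold firstIndex
    rw [← card_filter_eq_sum_ind]
    have : (Finset.range N).filter (fun i => ∀ j < i + 1, ¬P j) = Finset.range (Nat.find hex) := by
      ext i
      simp only [Finset.mem_filter, Finset.mem_range, Nat.lt_find_iff]
      exact ⟨fun h m hm => h.2 m (by omega), fun h =>
        ⟨lt_of_not_ge fun hi => h _ (hlt.le.trans hi) (Nat.find_spec hex),
          fun j hj => h j (by omega)⟩⟩
    rw [this, Finset.card_range]
  rw [this]
  exact ⟨hlt, Nat.find_spec hex⟩

/-! ### Closure of `Comp` under bounded sums, bounded quantifiers, arithmetic and search -/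

namespace Comp

variable {e : ℕ} {F G N : (ℕ → ℕ) → ℕ} {P Q : (ℕ → ℕ) → Prop}

theorem of_eq (h : Comp e F) (hFG : ∀ g, G g = F g) : Comp e G := by
  rwa [show G = F from funext hFG]

/-- Loading i into a fresh register turns the bound in terms of the registers into one that is
uniform in the summation index. -/
theorem body_le {f : ℕ → (ℕ → ℕ) → ℕ}
    (hf : ∀ e' ≥ e, ∀ I, Comp e' I → Comp e' fun g => f (I g) g) :
    ∃ c, ∀ g i, f i g ≤ (regSize e g + i) ^ c := by
  obtain ⟨c, hc⟩ := (hf (e + 1) (by omega) _ (reg (v := e) (by omega))).bdd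
  refine ⟨c, fun g i => ?_⟩
  have h := hc (Function.update g e i)
  have hlt : ∀ j < e, Function.update g e i j = g j := fun j hj => by simp [hj.ne]
  beta_reduce at h
  rw [regSize_succ, Function.update_self, regSize_congr hlt] at h
  rwa [(hf e le_rfl _ (const e i)).congr _ g hlt] at h

/-- Partial sums stay below N times a bound for the summands, which is the value bound that `natRec`
requires. Products, bounded quantifiers, counting and search are all reduced to such sums. -/
theorem sum {f : ℕ → (ℕ → ℕ) → ℕ} (hN : Comp e N)
    (hf : ∀ e' ≥ e, ∀ I, Comp e' I → Comp e' fun g => f (I g) g) :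
    Comp e fun g => ∑ i ∈ Finset.range (N g), f i g := by
  obtain ⟨c, hc⟩ := body_le hf
  have hrec : ∀ g n, ∑ i ∈ Finset.range n, f i g = Nat.rec 0 (fun i x => x + f i g) n := by
    intro g n
    induction n with
    | zero => rfl
    | succ n ih => rw [Finset.sum_range_succ, ih]
  refine of_eq (natRec (S := fun i x g => x + f i g) hN (const e 0)
    (fun e' he' I X hI hX => hX.add (hf e' he' I hI)) (fun g => N g * (regSize e g + N g) ^ c)
    (hN.bdd.mul ((PolyBdd.self.add (two_le_regSize e) hN.bdd).pow c)) fun g j hj => ?_)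
    fun g => hrec g _
  rw [← hrec]
  calc ∑ i ∈ Finset.range j, f i g ≤ ∑ i ∈ Finset.range j, (regSize e g + N g) ^ c := by
        refine Finset.sum_le_sum fun i hi => (hc g i).trans (Nat.pow_le_pow_left ?_ c)
        have := Finset.mem_range.1 hi
        omega
    _ ≤ N g * (regSize e g + N g) ^ c := by
        rw [Finset.sum_const, Finset.card_range, smul_eq_mul]
        exact Nat.mul_le_mul_right _ hj

theorem mul (hF : Comp e F) (hG : Comp e G) : Comp e fun g => F g * G g :=
  (hF.sum (f := fun _ g => G g) fun _ he' _ _ => hG.mono he').of_eq fun g => by simp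

theorem ind_le (hF : Comp e F) (hG : Comp e G) : Comp e fun g => ind (F g ≤ G g) :=
  ((const e 1).sub (hF.sub hG)).of_eq fun g => by
    by_cases h : F g ≤ G g
    · rw [ind_true h]; omega
    · rw [ind_false h]; omega

theorem ind_and (hP : Comp e fun g => ind (P g)) (hQ : Comp e fun g => ind (Q g)) :
    Comp e fun g => ind (P g ∧ Q g) :=
  (hP.mul hQ).of_eq fun g => by
    by_cases h : P g <;> by_cases h' : Q g <;> simp [ind, h, h']

theorem ind_not (hP : Comp e fun g => ind (P g)) : Comp e fun g => ind (¬P g) :=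
  ((const e 1).sub hP).of_eq fun g => by
    by_cases h : P g <;> simp [ind, h]

theorem ind_imp (hP : Comp e fun g => ind (P g)) (hQ : Comp e fun g => ind (Q g)) :
    Comp e fun g => ind (P g → Q g) :=
  (hP.ind_and hQ.ind_not).ind_not.of_eq fun g => by
    by_cases h : P g <;> by_cases h' : Q g <;> simp [ind, h, h']

theorem ind_eq (hF : Comp e F) (hG : Comp e G) : Comp e fun g => ind (F g = G g) :=
  ((hF.ind_le hG).ind_and (hG.ind_le hF)).of_eq fun _ =>
    congrArg ind (propext le_antisymm_iff)

theorem ind_forall {R : ℕ → (ℕ → ℕ) → Prop} (hN : Comp e N)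
    (hR : ∀ e' ≥ e, ∀ I, Comp e' I → Comp e' fun g => ind (R (I g) g)) :
    Comp e fun g => ind (∀ i < N g, R i g) :=
  ((const e 1).sub (hN.sum (f := fun i g => ind (¬R i g)) fun e' he' I hI =>
    (hR e' he' I hI).ind_not)).of_eq fun g => by
    by_cases h : ∀ i < N g, R i g
    · rw [ind_true h, Finset.sum_eq_zero fun i hi => ind_false (not_not.2
        (h i (Finset.mem_range.1 hi)))]
      rfl
    · rw [ind_false h]
      push Not at h
      obtain ⟨i, hi, hR⟩ := h
      have := Finset.single_le_sum (f := fun i => ind (¬R i g)) (fun _ _ => Nat.zero_le _)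
        (Finset.mem_range.2 hi)
      rw [ind_true hR] at this
      omega

theorem count {R : ℕ → (ℕ → ℕ) → Prop} [∀ g, DecidablePred fun i => R i g] (hN : Comp e N)
    (hR : ∀ e' ≥ e, ∀ I, Comp e' I → Comp e' fun g => ind (R (I g) g)) :
    Comp e fun g => ((Finset.range (N g)).filter fun i => R i g).card :=
  (hN.sum hR).of_eq fun _ => card_filter_eq_sum_ind _ _

/-- The quotient counts the positive multiples of the divisor up to the dividend. The guard `1 ≤ G
g` produces the value 0 for division by zero. -/
theorem div (hF : Comp e F) (hG : Comp e G) : Comp e fun g => F g / G g :=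
  (hF.count (R := fun i g => 1 ≤ G g ∧ (i + 1) * G g ≤ F g) fun e' he' I hI =>
    ((const e' 1).ind_le (hG.mono he')).ind_and
      (((hI.add (const e' 1)).mul (hG.mono he')).ind_le (hF.mono he'))).of_eq fun g => by
    rcases Nat.eq_zero_or_pos (G g) with h | h
    · simp [h]
    · have : (Finset.range (F g)).filter (fun i => 1 ≤ G g ∧ (i + 1) * G g ≤ F g) =
          Finset.range (F g / G g) := by
        ext i
        simp only [Finset.mem_filter, Finset.mem_range, ← Nat.succ_le_iff (n := F g / G g),
          Nat.le_div_iff_mul_le h]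
        exact ⟨fun h => h.2.2, fun h' => ⟨lt_of_lt_of_le (by nlinarith) h', h, h'⟩⟩
      rw [this, Finset.card_range]

theorem mod (hF : Comp e F) (hG : Comp e G) : Comp e fun g => F g % G g :=
  (hF.sub (hG.mul (hF.div hG))).of_eq fun _ => Nat.mod_eq_sub_mul_div

theorem min (hF : Comp e F) (hG : Comp e G) : Comp e fun g => min (F g) (G g) :=
  (hF.sub (hF.sub hG)).of_eq fun _ => by omega

/-- Without the cap the values would not be polynomially bounded and `natRec` would not apply. -/
theorem cappedPow {V : (ℕ → ℕ) → ℕ} (hV : Comp e V) (hF : Comp e F) (hG : Comp e G) :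
    Comp e fun g => cappedPow (V g) (F g) (G g) :=
  natRec (S := fun _ x g => Min.min (x * F g) (V g)) hG (const e 1)
    (fun _ he' _ _ _ hX => (hX.mul (hF.mono he')).min (hV.mono he')) (fun g => 1 + V g)
    ((PolyBdd.const (two_le_regSize e) 1).add (two_le_regSize e) hV.bdd) fun g j _ => by
    cases j with
    | zero => exact Nat.le_add_right _ _
    | succ j => exact (min_le_right _ _).trans (Nat.le_add_left _ _)

theorem firstIndex {R : ℕ → (ℕ → ℕ) → Prop} (hN : Comp e N)
    (hR : ∀ e' ≥ e, ∀ I, Comp e' I → Comp e' fun g => ind (R (I g) g)) :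
    Comp e fun g => firstIndex (fun i => R i g) (N g) :=
  hN.sum (f := fun i g => ind (∀ j < i + 1, ¬R j g)) fun _ he' _ hI =>
    (hI.add (const _ 1)).ind_forall fun e'' he'' I' hI' => (hR e'' (he'.trans he'') I' hI').ind_not

theorem logCount {V M R : (ℕ → ℕ) → ℕ} (hV : Comp e V) (hF : Comp e F) (hM : Comp e M)
    (hR : Comp e R) : Comp e fun g => logCount (_root_.cappedPow (V g) (F g)) (M g) (R g) :=
  hR.count fun e' he' _ hI =>
    ((hV.mono he').cappedPow (hF.mono he') (hI.add (const e' 1))).ind_le (hM.mono he')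

end Comp

/-! ### The stages of the construction -/

/-- The iterated logarithm, with powers computed by `pw`. -/
def logLog (pw : ℕ → ℕ → ℕ) (k : ℕ) : ℕ :=
  logCount (pw 2) (logCount (pw 2) k k) (logCount (pw 2) k k)

/-- With `p = (b ^ ·)`: the number of `i < q` such that the block of `h` base-`b` digits of `a / M`
that starts after `t + h * i` digits has the value `v`. -/
def blockCount (p : ℕ → ℕ) (M a t h q v : ℕ) : ℕ :=
  ((Finset.range q).filter fun i => p (t + h * (i + 1)) * a / M % p h = v).card

/-- With `p = (b ^ ·)`: all numbers of the cell `[a / M, (a + 1) / M]` share their first `L` base-`b`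
digits, and the blocks of at most `k` of the digits after the first `s` of them are distributed well,
uniformly over the initial segments. -/
def CellGood (p : ℕ → ℕ) (k l w s L M R a : ℕ) : Prop :=
  p L * a / M = p L * (a + 1) / M ∧
    ∀ h < k + 1, 1 ≤ h → ∀ c < h, ∀ q < R + 1, s + c + h * q ≤ L → ∀ v < p h,
      ((blockCount p M a (s + c) h q v * p h - q) + (q - blockCount p M a (s + c) h q v * p h)) *
        (h * h * h) ≤ l * w * p h

/-- The position at which stage `k` starts in base `b`. -/
def startPos (pw : ℕ → ℕ → ℕ) (b k : ℕ) : ℕ := logCount (pw b) (pw 2 (pw 4 k)) (pw 4 k) + 1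

/-- The number of base-`b` digits that are fixed by stage `k`. -/
def endPos (pw : ℕ → ℕ → ℕ) (b k : ℕ) : ℕ :=
  logCount (pw b) (pw 2 (pw 4 (k + 1))) (pw 4 (k + 1)) - k

/-- The requirement of stage `k`: `CellGood` for all bases that are active at this stage. -/
def StageGood (pw : ℕ → ℕ → ℕ) (K k a : ℕ) : Prop :=
  ∀ b < k, 2 ≤ b → K * b ≤ logLog pw k →
    CellGood (pw b) k (logLog pw k) (pw 2 k) (startPos pw b k) (endPos pw b k)
      (pw 2 (pw 4 (k + 1))) (pw 4 (k + 1)) a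

/-- The first good subcell of the cell `a` of stage `k`. -/
noncomputable def child (pw : ℕ → ℕ → ℕ) (K k a : ℕ) : ℕ :=
  a * pw 2 (pw 4 (k + 1) - pw 4 k) +
    firstIndex (fun i => StageGood pw K k (a * pw 2 (pw 4 (k + 1) - pw 4 k) + i))
      (pw 2 (pw 4 (k + 1) - pw 4 k))

/-- The first `4 ^ n` binary digits, as a number, capped at `V`. -/
noncomputable def stage (pw : ℕ → ℕ → ℕ) (V K n : ℕ) : ℕ :=
  Nat.rec 0 (fun k a => min (child pw K k a) V) n

/-- The binary digit with index `n`. -/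
noncomputable def stageDigit (pw : ℕ → ℕ → ℕ) (V K n : ℕ) : ℕ :=
  stage pw V K n / pw 2 (pw 4 n - (n + 1)) % 2

/-! ### Computability of the stages in time polynomial in the register contents -/

namespace Comp

variable {e : ℕ} {V b k a : (ℕ → ℕ) → ℕ}

theorem logLog (hV : Comp e V) (hk : Comp e k) :
    Comp e fun g => logLog (_root_.cappedPow (V g)) (k g) :=
  have h := hV.logCount (const e 2) hk hk
  hV.logCount (const e 2) h h

theorem blockCount {M t h q v : (ℕ → ℕ) → ℕ} (hV : Comp e V) (hb : Comp e b) (hM : Comp e M)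
    (ha : Comp e a) (ht : Comp e t) (hh : Comp e h) (hq : Comp e q) (hv : Comp e v) :
    Comp e fun g => blockCount (_root_.cappedPow (V g) (b g)) (M g) (a g) (t g) (h g) (q g) (v g) :=
  hq.count fun e' he' _ hI =>
    (((((hV.mono he').cappedPow (hb.mono he') ((ht.mono he').add ((hh.mono he').mul
      (hI.add (const e' 1))))).mul (ha.mono he')).div (hM.mono he')).mod
        ((hV.mono he').cappedPow (hb.mono he') (hh.mono he'))).ind_eq (hv.mono he')

theorem ind_cellGood {l w s L M R : (ℕ → ℕ) → ℕ} (hV : Comp e V) (hb : Comp e b) (hk : Comp e k)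
    (hl : Comp e l) (hw : Comp e w) (hs : Comp e s) (hL : Comp e L) (hM : Comp e M)
    (hR : Comp e R) (ha : Comp e a) :
    Comp e fun g => ind (CellGood (_root_.cappedPow (V g) (b g)) (k g) (l g) (w g) (s g) (L g)
      (M g) (R g) (a g)) := by
  refine ind_and ((((hV.cappedPow hb hL).mul ha).div hM).ind_eq
    (((hV.cappedPow hb hL).mul (ha.add (const e 1))).div hM)) ?_
  refine (hk.add (const e 1)).ind_forall fun e₁ he₁ h hh => ((const e₁ 1).ind_le hh).ind_imp ?_
  refine hh.ind_forall fun e₂ he₂ c hc => ?_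
  replace hh := hh.mono he₂
  have h₂ := he₁.trans he₂
  refine ((hR.mono h₂).add (const e₂ 1)).ind_forall fun e₃ he₃ q hq => ?_
  replace hh := hh.mono he₃
  replace hc := hc.mono he₃
  have h₃ := h₂.trans he₃
  have hsc := (hs.mono h₃).add hc
  refine ((hsc.add (hh.mul hq)).ind_le (hL.mono h₃)).ind_imp ?_
  refine ((hV.mono h₃).cappedPow (hb.mono h₃) hh).ind_forall fun e₄ he₄ v hv => ?_
  have h₄ := h₃.trans he₄
  replace hh := hh.mono he₄
  replace hq := hq.mono he₄
  replace hsc := hsc.mono he₄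
  have hB := (hV.mono h₄).cappedPow (hb.mono h₄) hh
  have hC := (blockCount (hV.mono h₄) (hb.mono h₄) (hM.mono h₄) (ha.mono h₄) hsc hh hq hv).mul hB
  exact (((hC.sub hq).add (hq.sub hC)).mul ((hh.mul hh).mul hh)).ind_le
    (((hl.mono h₄).mul (hw.mono h₄)).mul hB)

theorem bits (hV : Comp e V) (hk : Comp e k) :
    Comp e fun g => _root_.cappedPow (V g) 4 (k g) :=
  hV.cappedPow (const e 4) hk

theorem cells (hV : Comp e V) (hk : Comp e k) :
    Comp e fun g => _root_.cappedPow (V g) 2 (_root_.cappedPow (V g) 4 (k g)) :=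
  hV.cappedPow (const e 2) (hV.bits hk)

theorem ind_stageGood (K : ℕ) (hV : Comp e V) (hk : Comp e k) (ha : Comp e a) :
    Comp e fun g => ind (StageGood (_root_.cappedPow (V g)) K (k g) (a g)) := by
  refine hk.ind_forall fun e' he' b hb => ((const e' 2).ind_le hb).ind_imp ?_
  replace hV := hV.mono he'
  replace hk := hk.mono he'
  have hk1 := hk.add (const e' 1)
  refine (((const e' K).mul hb).ind_le (hV.logLog hk)).ind_imp ?_
  exact ind_cellGood hV hb hk (hV.logLog hk) (hV.cappedPow (const e' 2) hk)
    ((hV.logCount hb (hV.cells hk) (hV.bits hk)).add (const e' 1))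
    ((hV.logCount hb (hV.cells hk1) (hV.bits hk1)).sub hk) (hV.cells hk1) (hV.bits hk1)
    (ha.mono he')

theorem child (K : ℕ) (hV : Comp e V) (hk : Comp e k) (ha : Comp e a) :
    Comp e fun g => child (_root_.cappedPow (V g)) K (k g) (a g) := by
  have hD := hV.cappedPow (const e 2) ((hV.bits (hk.add (const e 1))).sub (hV.bits hk))
  exact (ha.mul hD).add (hD.firstIndex fun e' he' I hI => ind_stageGood K (hV.mono he')
    (hk.mono he') (((ha.mul hD).mono he').add hI))

theorem stage (K : ℕ) (hV : Comp e V) (hk : Comp e k) :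
    Comp e fun g => stage (_root_.cappedPow (V g)) (V g) K (k g) :=
  natRec (S := fun i x g => Min.min (_root_.child (_root_.cappedPow (V g)) K i x) (V g)) hk
    (const e 0) (fun _ he' _ _ hI hX => (child K (hV.mono he') hI hX).min (hV.mono he'))
    V hV.bdd fun g j _ => by
    cases j with
    | zero => exact Nat.zero_le _
    | succ j => exact min_le_right _ _

theorem stageDigit (K : ℕ) (hV : Comp e V) (hk : Comp e k) :
    Comp e fun g => stageDigit (_root_.cappedPow (V g)) (V g) K (k g) :=
  ((stage K hV hk).div (hV.cappedPow (const e 2) ((hV.bits hk).sub (hk.add (const e 1))))).mod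
    (const e 2)

end Comp

/-! ### The program -/

/-- The bound up to which powers are needed for the digit with index `n`. -/
def powBound (n : ℕ) : ℕ := 2 ^ 2 ^ (4 * n + 4)

theorem powBound_succ (n : ℕ) : powBound (n + 1) = powBound n ^ 16 := by
  rw [powBound, powBound, ← pow_mul]
  ring_nf

theorem le_powBound (n : ℕ) : 4 * n + 16 ≤ powBound n := by
  have h1 : 2 ^ (4 * n + 4) < powBound n := Nat.lt_two_pow_self
  have h2 : 4 * n < 2 ^ (4 * n) := Nat.lt_two_pow_self
  rw [pow_add] at h1
  omega

/-- A function of `n` and `powBound n` that is computed in polynomial time gives rise to a program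
that outputs its values one after the other. -/
theorem exists_prog_of_comp {D : ℕ → ℕ → ℕ} (hD : Comp 2 fun g => D (g 0) (g 1)) :
    ∃ (p : Prog) (c : ℕ), ∀ n, ∃ t ≤ 2 ^ 2 ^ 2 ^ (c * n),
      p.outputAfter t = (List.range n).map fun i => D i (powBound i) := by
  have hV : Comp 2 fun g => g 1 ^ 16 := by
    have h1 : Comp 2 fun g => g 1 := Comp.reg (by norm_num)
    have h2 := h1.mul h1
    have h4 := h2.mul h2
    have h8 := h4.mul h4
    exact (h8.mul h8).of_eq fun g => by ring
  obtain ⟨pD, TD, ⟨cD, hTD⟩, hpD⟩ := hD.prog 3 (by norm_num)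
  obtain ⟨pV, TV, ⟨cV, hTV⟩, hpV⟩ := hV.prog 3 (by norm_num)
  -- Register 0 holds n, register 1 holds `powBound n`, and register 2 holds 1, which both keeps the
  -- loop alive and increments n.
  set body : Prog := .seq pD (.seq (.emit 3) (.seq pV (.seq (.const 4 0)
    (.seq (.add 1 3 4) (.add 0 0 2))))) with hbody
  set C := 2 * cD + 2 * cV + 2 with hC
  have hiter : ∀ n g o, g 0 = n → g 1 = powBound n → g 2 = 1 → ∃ t ≤ powBound n ^ C, ∃ g',
      Config.step^[t] ⟨[.loop 2 body], g, o⟩ = ⟨[.loop 2 body], g', o ++ [D n (powBound n)]⟩ ∧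
        g' 0 = n + 1 ∧ g' 1 = powBound (n + 1) ∧ g' 2 = 1 := by
    intro n g o h0 h1 h2
    obtain ⟨t₁, ht₁, g₁, hr₁, hk₁, hv₁⟩ := hpD g
    obtain ⟨t₂, ht₂, g₂, hr₂, hk₂, hv₂⟩ := hpV g₁
    have hV2 := le_powBound n
    have hsz : regSize 3 g ≤ powBound n ^ 2 := by
      simp only [regSize, Finset.sum_range_succ, Finset.sum_range_zero, h0, h1, h2]
      nlinarith
    have hsz₁ : regSize 3 g₁ ≤ powBound n ^ 2 := by rwa [regSize_congr hk₁]
    have hb₁ : TD g ≤ powBound n ^ (2 * cD + 2 * cV) :=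
      ((hTD g).trans (Nat.pow_le_pow_left hsz cD)).trans (by
        rw [← pow_mul]; exact Nat.pow_le_pow_right (by omega) (by omega))
    have hb₂ : TV g₁ ≤ powBound n ^ (2 * cD + 2 * cV) :=
      ((hTV g₁).trans (Nat.pow_le_pow_left hsz₁ cV)).trans (by
        rw [← pow_mul]; exact Nat.pow_le_pow_right (by omega) (by omega))
    have hone : 1 ≤ powBound n ^ (2 * cD + 2 * cV) := Nat.one_le_pow _ _ (by omega)
    -- Two steps enter the loop and expose `pD`, three output the digit and expose `pV`, five
    -- perform the updates.
    have hstep : ∀ (K : List Prog) f w, Config.step^[5 + (t₂ + (3 + (t₁ + 2)))]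
        ⟨.loop 2 body :: K, f, w⟩ = Config.step^[5] (Config.step^[t₂] (Config.step^[3]
          (Config.step^[t₁] (Config.step^[2] ⟨.loop 2 body :: K, f, w⟩)))) := fun K f w => by
      simp only [Function.iterate_add_apply]
    have hfirst : Config.step^[2] ⟨[.loop 2 body], g, o⟩ =
        ⟨pD :: .seq (.emit 3) (.seq pV (.seq (.const 4 0) (.seq (.add 1 3 4) (.add 0 0 2)))) ::
          [.loop 2 body], g, o⟩ := by
      simp [Config.step, h2, hbody]
    refine ⟨5 + (t₂ + (3 + (t₁ + 2))), ?_, Function.update (Function.update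
      (Function.update g₂ 4 0) 1 (powBound (n + 1))) 0 (n + 1), ?_, ?_, ?_, ?_⟩
    · rw [hC, pow_add]
      have : 12 ≤ powBound n ^ 2 := by nlinarith
      exact le_trans (by omega) (Nat.mul_le_mul_left _ this)
    · rw [hstep, hfirst, hr₁]
      change Config.step^[5] (Config.step^[t₂] ⟨pV :: _, g₁, o ++ [g₁ 3]⟩) = _
      rw [hr₂]
      have e3 : Function.update g₂ 4 0 3 = powBound (n + 1) := by
        rw [Function.update_of_ne (by norm_num), hv₂, hk₁ 1 (by norm_num), h1, powBound_succ]
      have e0 : g₂ 0 = n := by rw [hk₂ 0 (by norm_num), hk₁ 0 (by norm_num), h0]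
      have e2 : g₂ 2 = 1 := by rw [hk₂ 2 (by norm_num), hk₁ 2 (by norm_num), h2]
      have e3' : g₂ 3 = powBound (n + 1) := by simpa using e3
      simp [Config.step, hv₁, h0, h1, e0, e2, e3']
    · simp
    · simp
    · simp [hk₂, hk₁, h2]
  -- 65536 is `powBound 0`. The constant C + 9 gives (C + 9)·n ≥ 4n + C + 5 for n ≥ 1.
  refine ⟨.seq (.const 0 0) (.seq (.const 1 65536) (.seq (.const 2 1) (.loop 2 body))), C + 9,
    fun n => ?_⟩
  rcases Nat.eq_zero_or_pos n with rfl | hn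
  -- For n = 0 only four steps are allowed, fewer than the initialisation takes, but the output is
  -- empty at time 0.
  · exact ⟨0, Nat.zero_le _, rfl⟩
  have hmain : ∀ n, ∃ t ≤ powBound n ^ (C + 1), ∃ g, Config.step^[t]
      ⟨[.seq (.const 0 0) (.seq (.const 1 65536) (.seq (.const 2 1) (.loop 2 body)))],
        fun _ => 0, []⟩ =
      ⟨[.loop 2 body], g, (List.range n).map fun i => D i (powBound i)⟩ ∧
        g 0 = n ∧ g 1 = powBound n ∧ g 2 = 1 := by
    intro n
    induction n with
    | zero =>
      refine ⟨6, ?_, _, rfl, ?_, ?_, ?_⟩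
      · have := le_powBound 0
        calc 6 ≤ powBound 0 ^ 1 := by rw [pow_one]; omega
          _ ≤ powBound 0 ^ (C + 1) := Nat.pow_le_pow_right (by omega) (by omega)
      · simp
      · simp [powBound]
      · simp
    | succ n ih =>
      obtain ⟨t, ht, g, hg, h0, h1, h2⟩ := ih
      obtain ⟨t', ht', g', hg', h'⟩ := hiter n g ((List.range n).map fun i => D i (powBound i))
        h0 h1 h2
      refine ⟨t' + t, ?_, g', ?_, h'⟩
      · have hV2 := le_powBound n
        have hp : 0 < powBound n ^ C := Nat.pow_pos (by omega)
        calc t' + t ≤ powBound n ^ C + powBound n ^ C * powBound n := by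
              rw [pow_succ] at ht; omega
          _ = powBound n ^ C * (1 + powBound n) := by ring
          _ ≤ powBound n ^ C * (powBound n * powBound n) :=
              Nat.mul_le_mul_left _ (by nlinarith)
          _ = powBound n ^ (C + 2) := by ring
          _ ≤ powBound n ^ (16 * (C + 1)) := Nat.pow_le_pow_right (by omega) (by omega)
          _ = powBound (n + 1) ^ (C + 1) := by rw [powBound_succ, ← pow_mul]
      · rw [Function.iterate_add_apply, hg, hg', List.range_succ, List.map_append]
        rfl
  obtain ⟨t, ht, g, hg, -⟩ := hmain n
  refine ⟨t, ht.trans ?_, ?_⟩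
  · rw [powBound, ← pow_mul]
    refine Nat.pow_le_pow_right (by norm_num) ?_
    calc 2 ^ (4 * n + 4) * (C + 1) ≤ 2 ^ (4 * n + 4) * 2 ^ (C + 1) :=
          Nat.mul_le_mul_left _ Nat.lt_two_pow_self.le
      _ = 2 ^ (4 * n + 4 + (C + 1)) := by rw [← pow_add]
      _ ≤ 2 ^ 2 ^ ((C + 9) * n) := by
          refine Nat.pow_le_pow_right (by norm_num) ?_
          have : (C + 9) * n < 2 ^ ((C + 9) * n) := Nat.lt_two_pow_self
          nlinarith
  · rw [Prog.outputAfter, hg]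

/-! ### Capped powers do not matter -/

/-- The function `pw` computes the powers that occur at stage `k`. -/
def PowUpTo (pw : ℕ → ℕ → ℕ) (k : ℕ) : Prop :=
  ∀ b e, 1 ≤ b → b ≤ 2 ^ (k + 2) → e ≤ 4 ^ (k + 1) → pw b e = b ^ e

/-- The largest power in question is at most 2^((k+2)·4^(k+1)) ≤ 2^(2^(3k+4)), which explains the
size of `powBound`. -/
theorem powUpTo_cappedPow {V k : ℕ} (hV : powBound k ≤ V) : PowUpTo (cappedPow V) k := by
  intro b e hb1 hb he
  refine cappedPow_eq hb1 (le_trans ?_ hV)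
  calc b ^ e ≤ (2 ^ (k + 2)) ^ e := Nat.pow_le_pow_left hb e
    _ ≤ (2 ^ (k + 2)) ^ 4 ^ (k + 1) := Nat.pow_le_pow_right (by positivity) he
    _ = 2 ^ ((k + 2) * 4 ^ (k + 1)) := by rw [← pow_mul]
    _ ≤ powBound k := by
        refine Nat.pow_le_pow_right (by norm_num) ?_
        calc (k + 2) * 4 ^ (k + 1) ≤ 2 ^ (k + 2) * 4 ^ (k + 1) :=
              Nat.mul_le_mul_right _ Nat.lt_two_pow_self.le
          _ = 2 ^ (3 * k + 4) := by
              rw [show (4 : ℕ) = 2 ^ 2 by norm_num, ← pow_mul, ← pow_add]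
              congr 1
              omega
          _ ≤ 2 ^ (4 * k + 4) := Nat.pow_le_pow_right (by norm_num) (by omega)

theorem powBound_mono {k n : ℕ} (h : k ≤ n) : powBound k ≤ powBound n :=
  Nat.pow_le_pow_right (by norm_num) (Nat.pow_le_pow_right (by norm_num) (by omega))

theorem logCount_le (p : ℕ → ℕ) (M R : ℕ) : logCount p M R ≤ R :=
  (Finset.card_filter_le _ _).trans (Finset.card_range R).le

theorem logCount_congr {p p' : ℕ → ℕ} {M R : ℕ} (h : ∀ e ≤ R, p e = p' e) :
    logCount p M R = logCount p' M R := by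
  unfold logCount
  congr 1
  refine Finset.filter_congr fun i hi => ?_
  rw [h _ (Finset.mem_range.1 hi)]

/-- Every exponent that occurs in `CellGood` is at most R. -/
theorem cellGood_congr {p p' : ℕ → ℕ} {k l w s L M R a : ℕ} (h : ∀ e ≤ R, p e = p' e)
    (hL : L ≤ R) (hk : k ≤ R) : CellGood p k l w s L M R a ↔ CellGood p' k l w s L M R a := by
  unfold CellGood
  rw [h L hL]
  refine and_congr Iff.rfl (forall_congr' fun b => forall_congr' fun hb => forall_congr' fun _ =>
    forall_congr' fun c => forall_congr' fun _ => forall_congr' fun q => forall_congr' fun _ =>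
    forall_congr' fun hq => ?_)
  have hC : ∀ v, blockCount p M a (s + c) b q v = blockCount p' M a (s + c) b q v := by
    intro v
    unfold blockCount
    congr 1
    refine Finset.filter_congr fun i hi => ?_
    have := Nat.mul_le_mul_left b (Nat.succ_le_of_lt (Finset.mem_range.1 hi))
    rw [h b (by omega), h _ (by simp only [Nat.succ_eq_add_one] at this; omega)]
  simp only [h b (by omega), hC]

theorem PowUpTo.two {pw : ℕ → ℕ → ℕ} {k e : ℕ} (h : PowUpTo pw k) (he : e ≤ 4 ^ (k + 1)) :
    pw 2 e = 2 ^ e :=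
  h 2 e (by norm_num) (by rw [pow_add]; have := Nat.one_le_two_pow (n := k); omega) he

theorem PowUpTo.four {pw : ℕ → ℕ → ℕ} {k e : ℕ} (h : PowUpTo pw k) (he : e ≤ 4 ^ (k + 1)) :
    pw 4 e = 4 ^ e :=
  h 4 e (by norm_num) (by rw [pow_add]; have := Nat.one_le_two_pow (n := k); omega) he

theorem succ_le_four_pow (k : ℕ) : k + 1 ≤ 4 ^ (k + 1) := (Nat.lt_pow_self (by norm_num)).le

theorem PowUpTo.logLog {pw : ℕ → ℕ → ℕ} {k : ℕ} (h : PowUpTo pw k) :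
    logLog pw k = logLog (· ^ ·) k := by
  have hk := succ_le_four_pow k
  have h1 : ∀ R ≤ k, ∀ M, logCount (pw 2) M R = logCount (2 ^ ·) M R := fun R hR M =>
    logCount_congr fun e he => h.two (by omega)
  unfold _root_.logLog
  rw [h1 k le_rfl, h1 _ (logCount_le _ _ _)]

theorem PowUpTo.stageGood {pw : ℕ → ℕ → ℕ} {k : ℕ} (h : PowUpTo pw k) (K a : ℕ) :
    StageGood pw K k a ↔ StageGood (· ^ ·) K k a := by
  have hk := succ_le_four_pow k
  have hk4 : 4 ^ k ≤ 4 ^ (k + 1) := Nat.pow_le_pow_right (by norm_num) (by omega)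
  unfold StageGood
  rw [h.logLog]
  refine forall_congr' fun b => forall_congr' fun hb => forall_congr' fun hb2 =>
    forall_congr' fun _ => ?_
  have hpb : ∀ e ≤ 4 ^ (k + 1), pw b e = b ^ e := fun e he => h b e (by omega)
    (hb.le.trans ((Nat.lt_two_pow_self).le.trans (Nat.pow_le_pow_right (by norm_num) (by omega)))) he
  have hs : startPos pw b k = startPos (· ^ ·) b k := by
    unfold startPos
    rw [h.four (by omega : k ≤ _), h.two hk4, logCount_congr fun e he => hpb e (he.trans hk4)]
  have hL : endPos pw b k = endPos (· ^ ·) b k := by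
    unfold endPos
    rw [h.four hk, h.two le_rfl, logCount_congr hpb]
  rw [hs, hL, h.four hk, h.two le_rfl, h.two (by omega : k ≤ _)]
  exact cellGood_congr hpb ((Nat.sub_le _ _).trans (logCount_le _ _ _)) (by omega)

theorem PowUpTo.child {pw : ℕ → ℕ → ℕ} {k : ℕ} (h : PowUpTo pw k) (K a : ℕ) :
    child pw K k a = child (· ^ ·) K k a := by
  have hk := succ_le_four_pow k
  unfold _root_.child
  rw [h.four hk, h.four (by omega : k ≤ _), h.two (Nat.sub_le _ _)]
  simp only [h.stageGood]

theorem stage_cappedPow {V n : ℕ} (hV : powBound n ≤ V) (K : ℕ) :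
    stage (cappedPow V) V K n = stage (· ^ ·) V K n := by
  induction n with
  | zero => rfl
  | succ n ih =>
    have hn := (powBound_mono (Nat.le_succ n)).trans hV
    change min (child (cappedPow V) K n (stage (cappedPow V) V K n)) V =
      min (child (· ^ ·) K n (stage (· ^ ·) V K n)) V
    rw [ih hn, (powUpTo_cappedPow hn).child]

theorem stageDigit_cappedPow (n K : ℕ) :
    stageDigit (cappedPow (powBound n)) (powBound n) K n =
      stageDigit (· ^ ·) (powBound n) K n := by
  have h := powUpTo_cappedPow (le_refl (powBound n))
  have hk := succ_le_four_pow n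
  unfold stageDigit
  rw [stage_cappedPow le_rfl, h.four (by omega : n ≤ _), h.two ((Nat.sub_le _ _).trans
    (Nat.pow_le_pow_right (by norm_num) (by omega)))]

/-! ### Fourth moments and a maximal inequality for digit counts -/

theorem sum_range_mul_eq {M : Type*} [AddCommMonoid M] (B R : ℕ) (f : ℕ → M) :
    ∑ z ∈ Finset.range (B * R), f z =
      ∑ t ∈ Finset.range B, ∑ y ∈ Finset.range R, f (t * R + y) := by
  induction B with
  | zero => simp
  | succ B ih => rw [add_mul, one_mul, Finset.sum_range_add, ih, Finset.sum_range_succ]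

/-- The sum of `ξ` over the first `q` of the `n` base-`B` digits of `z`. -/
def digitSum (B : ℕ) (ξ : ℕ → ℤ) (n q z : ℕ) : ℤ :=
  ∑ i ∈ Finset.range q, ξ (z / B ^ (n - 1 - i) % B)

/-- Digits are read from the most significant one, so splitting off the leading digit is
conditioning on the first step of the walk. -/
theorem digitSum_cons {B n q t y : ℕ} (ξ : ℕ → ℤ) (hq : q ≤ n) (ht : t < B) (hy : y < B ^ n) :
    digitSum B ξ (n + 1) (q + 1) (t * B ^ n + y) = ξ t + digitSum B ξ n q y := by
  have hB : 0 < B := by omega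
  unfold digitSum
  rw [Finset.sum_range_succ', add_comm]
  congr 1
  · rw [show n + 1 - 1 - 0 = n by omega, add_comm, Nat.add_mul_div_right _ _ (by positivity),
      Nat.div_eq_of_lt hy, zero_add, Nat.mod_eq_of_lt ht]
  · refine Finset.sum_congr rfl fun i hi => ?_
    have hi := Finset.mem_range.1 hi
    rw [show n + 1 - 1 - (i + 1) = n - 1 - i by omega]
    have : t * B ^ n = (t * B ^ i * B) * B ^ (n - 1 - i) := by
      rw [mul_assoc, mul_assoc, ← pow_succ', ← pow_add]
      congr 2
      omega
    rw [this, add_comm, Nat.add_mul_div_right _ _ (by positivity), Nat.add_mul_mod_self_right]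

theorem sum_digitSum_succ {B n : ℕ} (ξ : ℕ → ℤ) (f : ℤ → ℤ) (s : ℤ) :
    ∑ z ∈ Finset.range (B ^ (n + 1)), f (s + digitSum B ξ (n + 1) (n + 1) z) =
      ∑ t ∈ Finset.range B, ∑ z ∈ Finset.range (B ^ n), f (s + ξ t + digitSum B ξ n n z) := by
  rw [pow_succ', sum_range_mul_eq]
  refine Finset.sum_congr rfl fun t ht => Finset.sum_congr rfl fun y hy => ?_
  rw [digitSum_cons ξ le_rfl (Finset.mem_range.1 ht) (Finset.mem_range.1 hy), add_assoc]

/-- The hypothesis is the one-step submartingale property of φ along the walk; it is iterated over n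
digits. -/
theorem le_sum_digitSum {B : ℕ} {ξ : ℕ → ℤ} {φ : ℤ → ℤ}
    (hφ : ∀ s, B * φ s ≤ ∑ t ∈ Finset.range B, φ (s + ξ t)) (n : ℕ) (s : ℤ) :
    (B ^ n : ℕ) * φ s ≤ ∑ z ∈ Finset.range (B ^ n), φ (s + digitSum B ξ n n z) := by
  induction n generalizing s with
  | zero => simp [digitSum]
  | succ n ih =>
    rw [sum_digitSum_succ]
    calc ((B ^ (n + 1) : ℕ) : ℤ) * φ s = (B ^ n : ℕ) * (B * φ s) := by push_cast; ring
      _ ≤ (B ^ n : ℕ) * ∑ t ∈ Finset.range B, φ (s + ξ t) :=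
          mul_le_mul_of_nonneg_left (hφ s) (by positivity)
      _ ≤ _ := by
          rw [Finset.mul_sum]
          exact Finset.sum_le_sum fun t _ => ih (s + ξ t)

/-- A maximal inequality of Doob's type, for sums over independent digits. -/
theorem maximal_digitSum {B : ℕ} {ξ : ℕ → ℤ} {φ : ℤ → ℤ} (hφ0 : ∀ s, 0 ≤ φ s)
    (hφ : ∀ s, B * φ s ≤ ∑ t ∈ Finset.range B, φ (s + ξ t)) {P : ℤ → Prop} {X : ℕ}
    (hP : ∀ s, P s → (X : ℤ) ≤ φ s) (n : ℕ) (s : ℤ) :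
    (∑ z ∈ Finset.range (B ^ n), ind (∃ q ≤ n, P (s + digitSum B ξ n q z)) : ℕ) * (X : ℤ) ≤
      ∑ z ∈ Finset.range (B ^ n), φ (s + digitSum B ξ n n z) := by
  have hind : ∀ Q : Prop, ind Q ≤ 1 := fun Q => by unfold ind; split_ifs <;> norm_num
  induction n generalizing s with
  | zero =>
    by_cases h : P s
    · simpa [digitSum, ind, h] using hP s h
    · simpa [digitSum, ind, h] using hφ0 s
  | succ n ih =>
    -- Optional stopping: if P holds at once, the submartingale property finishes; otherwise
    -- condition on the first digit and restart from the shifted sum.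
    by_cases h : P s
    · refine le_trans ?_ (le_sum_digitSum hφ (n + 1) s)
      refine mul_le_mul ?_ (hP s h) (by positivity) (by positivity)
      refine Nat.cast_le.2 ((Finset.sum_le_sum fun z _ => hind _).trans ?_)
      simp
    · rw [sum_digitSum_succ, pow_succ', sum_range_mul_eq]
      push_cast
      rw [Finset.sum_mul]
      refine Finset.sum_le_sum fun t ht => ?_
      refine le_trans (le_of_eq ?_) (ih (s + ξ t))
      push_cast
      congr 1
      refine Finset.sum_congr rfl fun y hy => ?_
      congr 2
      refine propext ⟨?_, ?_⟩
      · rintro ⟨q, hq, hPq⟩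
        cases q with
        | zero => exact absurd (by simpa [digitSum] using hPq) h
        | succ q =>
          refine ⟨q, by omega, ?_⟩
          rwa [digitSum_cons ξ (by omega) (Finset.mem_range.1 ht) (Finset.mem_range.1 hy),
            ← add_assoc] at hPq
      · rintro ⟨q, hq, hPq⟩
        refine ⟨q + 1, by omega, ?_⟩
        rwa [digitSum_cons ξ hq (Finset.mem_range.1 ht) (Finset.mem_range.1 hy), ← add_assoc]

/-- The centred indicator of the digit `v`, times `B`. -/
def centred (B v t : ℕ) : ℤ := if t = v then (B : ℤ) - 1 else -1

theorem sum_centred {B v : ℕ} (hv : v < B) (f : ℤ → ℤ) :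
    ∑ t ∈ Finset.range B, f (centred B v t) = f (B - 1) + (B - 1) * f (-1) := by
  have : ∀ t, f (centred B v t) = f (-1) + if t = v then f (B - 1) - f (-1) else 0 := by
    intro t
    unfold centred
    split_ifs <;> ring
  simp only [this]
  rw [Finset.sum_add_distrib, Finset.sum_ite_eq' (Finset.range B) v,
    if_pos (Finset.mem_range.2 hv), Finset.sum_const, Finset.card_range, nsmul_eq_mul]
  ring

/-- The shift s is there for the induction over the leading digit. A centred digit has mean 0,
second moment B - 1, third moment (B - 1)(B - 2) and fourth moment at most B³. -/
theorem fourth_moment_le {B v : ℕ} (hv : v < B) (n : ℕ) (s : ℤ) :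
    ∑ z ∈ Finset.range (B ^ n), (s + digitSum B (centred B v) n n z) ^ 4 ≤
      (B ^ n : ℕ) * (s ^ 4 + 6 * n * (B - 1) * s ^ 2 + 4 * n * ((B - 1) * (B - 2)) * s +
        3 * n ^ 2 * (B - 1) ^ 2 + n * B ^ 3) := by
  have hB : (1 : ℤ) ≤ B := by exact_mod_cast (by omega : 1 ≤ B)
  induction n generalizing s with
  | zero => simp [digitSum]
  | succ n ih =>
    rw [sum_digitSum_succ _ (fun x => x ^ 4)]
    refine (Finset.sum_le_sum fun t _ => ih _).trans ?_
    rw [← Finset.mul_sum, sum_centred hv (fun x => (s + x) ^ 4 + 6 * n * (B - 1) * (s + x) ^ 2 +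
      4 * n * ((B - 1) * (B - 2)) * (s + x) + 3 * n ^ 2 * (B - 1) ^ 2 + n * B ^ 3)]
    have h4 : ((B : ℤ) - 1) ^ 4 + (B - 1) ≤ B * B ^ 3 := by
      obtain ⟨c, rfl⟩ : ∃ c, B = c + 1 := ⟨B - 1, by omega⟩
      have : (0 : ℤ) ≤ 4 * c ^ 3 + 6 * c ^ 2 + 3 * c + 1 := by positivity
      push_cast
      linarith
    have hsq : (0 : ℤ) ≤ B * (3 * (B - 1) ^ 2) := by positivity
    have hpow : ((B ^ (n + 1) : ℕ) : ℤ) = (B ^ n : ℕ) * B := by push_cast; ring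
    rw [hpow, mul_assoc ((B ^ n : ℕ) : ℤ) B]
    refine mul_le_mul_of_nonneg_left ?_ (Nat.cast_nonneg _)
    push_cast
    linarith

theorem digitSum_centred (B v n q z : ℕ) : digitSum B (centred B v) n q z =
    ((Finset.range q).filter fun i => z / B ^ (n - 1 - i) % B = v).card * B - q := by
  unfold digitSum centred
  have : ∀ t : ℕ, (if t = v then (B : ℤ) - 1 else -1) = (if t = v then 1 else 0) * B - 1 := by
    intro t
    split_ifs <;> ring
  simp only [this]
  rw [Finset.sum_sub_distrib, ← Finset.sum_mul, Finset.sum_boole]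
  simp

/-- The number of strings of `n` base-`B` digits in which the frequency of the digit `v` in an
initial segment deviates much from its expectation. -/
theorem deviation_count_le {B v : ℕ} (hv : v < B) (n : ℕ) {w X : ℕ} {P : ℤ → Prop}
    (hP : ∀ s, P s → (X : ℤ) ≤ w * s ^ 4) :
    (∑ z ∈ Finset.range (B ^ n), ind (∃ q ≤ n, P
      (((Finset.range q).filter fun i => z / B ^ (n - 1 - i) % B = v).card * B - q : ℤ))) * X ≤
      w * (B ^ n * (3 * n ^ 2 * B ^ 2 + n * B ^ 3)) := by
  have hB : (1 : ℤ) ≤ B := by exact_mod_cast (by omega : 1 ≤ B)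
  have h := maximal_digitSum (ξ := centred B v) (φ := fun s => w * s ^ 4) (B := B)
    (fun s => by positivity) (fun s => by
      rw [sum_centred hv (fun x => w * (s + x) ^ 4)]
      -- The tangent inequality for the convex fourth power; averaged over a step of mean zero it
      -- gives the submartingale property.
      have h1 : ∀ x : ℤ, s ^ 4 + 4 * s ^ 3 * x ≤ (s + x) ^ 4 := fun x => by
        nlinarith [mul_nonneg (sq_nonneg x) (sq_nonneg (2 * s + x)),
          mul_nonneg (sq_nonneg x) (sq_nonneg s)]
      have hw : (0 : ℤ) ≤ w := by positivity
      have e1 := mul_le_mul_of_nonneg_left (h1 (B - 1)) hw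
      have e2 := mul_le_mul_of_nonneg_left (h1 (-1)) hw
      have e3 := mul_le_mul_of_nonneg_left e2 (sub_nonneg.2 hB)
      nlinarith) hP n 0
  have h4 := fourth_moment_le hv n 0
  simp only [zero_add, digitSum_centred] at h h4
  have h5 : (3 * n ^ 2 * ((B : ℤ) - 1) ^ 2 + n * B ^ 3) ≤ 3 * n ^ 2 * B ^ 2 + n * B ^ 3 := by
    have : ((B : ℤ) - 1) ^ 2 ≤ B ^ 2 := by nlinarith
    have := mul_le_mul_of_nonneg_left this (by positivity : (0 : ℤ) ≤ 3 * n ^ 2)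
    linarith
  rw [← Finset.mul_sum] at h
  rw [← Nat.cast_le (α := ℤ)]
  push_cast at h h4 ⊢
  refine h.trans (mul_le_mul_of_nonneg_left (h4.trans ?_) (by positivity))
  refine mul_le_mul_of_nonneg_left ?_ (by positivity)
  linarith

/-! ### Existence of good subcells -/

theorem logCount_pow {b M R : ℕ} (hb : 2 ≤ b) (hM : M ≤ 2 ^ R) :
    logCount (b ^ ·) M R = Nat.log b M := by
  rcases Nat.eq_zero_or_pos M with rfl | hM0
  · simp [logCount]
    omega
  · unfold logCount
    have : (Finset.range R).filter (fun i => b ^ (i + 1) ≤ M) = Finset.range (Nat.log b M) := by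
      ext i
      simp only [Finset.mem_filter, Finset.mem_range]
      rw [← Nat.le_log_iff_pow_le (by omega) hM0.ne', Nat.succ_le_iff]
      refine ⟨fun h => h.2, fun h => ⟨h.trans_le ?_, h⟩⟩
      have h1 : 2 ^ Nat.log b M ≤ 2 ^ R :=
        (Nat.pow_le_pow_left hb _).trans ((Nat.pow_log_le_self b hM0.ne').trans hM)
      exact (Nat.pow_le_pow_iff_right (by norm_num)).1 h1
    rw [this, Finset.card_range]

theorem logLog_eq (k : ℕ) : logLog (· ^ ·) k = Nat.log 2 (Nat.log 2 k) := by
  have h : ∀ k, logCount (2 ^ ·) k k = Nat.log 2 k := fun k =>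
    logCount_pow le_rfl Nat.lt_two_pow_self.le
  change logCount (2 ^ ·) (logCount (2 ^ ·) k k) (logCount (2 ^ ·) k k) = _
  rw [h, h]

theorem startPos_eq {b : ℕ} (hb : 2 ≤ b) (k : ℕ) :
    startPos (· ^ ·) b k = Nat.log b (2 ^ 4 ^ k) + 1 := by
  unfold startPos
  rw [logCount_pow hb le_rfl]

theorem endPos_eq {b : ℕ} (hb : 2 ≤ b) (k : ℕ) :
    endPos (· ^ ·) b k = Nat.log b (2 ^ 4 ^ (k + 1)) - k := by
  unfold endPos
  rw [logCount_pow hb le_rfl]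

/-! ### Base-b digits over the dyadic subcells of a cell -/

theorem card_floor_fiber_le {N M : ℕ} (hN : 0 < N) (hM : 0 < M) (s : Finset ℕ) (y : ℕ) :
    (s.filter fun x => N * x / M = y).card ≤ M / N + 1 := by
  set c := (y * M + N - 1) / N with hc
  have hc1 : y * M ≤ N * c := by
    have := Nat.lt_mul_div_succ (y * M + N - 1) hN
    rw [← hc, mul_add] at this
    omega
  have hsub : (s.filter fun x => N * x / M = y) ⊆ Finset.Ico c (c + (M / N + 1)) := by
    intro x hx
    have hx := (Finset.mem_filter.1 hx).2
    rw [Nat.div_eq_iff hM] at hx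
    obtain ⟨h1, h2⟩ := hx
    rw [Finset.mem_Ico]
    constructor
    · rw [hc]
      refine Nat.lt_succ_iff.1 (Nat.div_lt_of_lt_mul ?_)
      rw [Nat.mul_succ]
      omega
    · by_contra! h
      have h3 : N * (c + (M / N + 1)) ≤ N * x := Nat.mul_le_mul_left N h
      have h4 := Nat.lt_mul_div_succ M hN
      rw [mul_add] at h3
      omega
  calc _ ≤ _ := Finset.card_le_card hsub
    _ = _ := by simp

/-- The last digits of `⌊E * R * x / M⌋` are nearly equidistributed when `x` runs through the
subcells of a cell. -/
theorem equidistribution {a W U E R : ℕ} (hW : 0 < W) (hWE : W ≤ E) (hR : 0 < R)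
    (hER : E * R ≤ W * U) (P : ℕ → Prop) [DecidablePred P] :
    ((Finset.range U).filter fun i => P (E * R * (a * U + i) / (W * U) % R)).card * R ≤
      6 * U * ((Finset.range R).filter P).card := by
  have hE : 0 < E := by omega
  have hERp : 0 < E * R := Nat.mul_pos hE hR
  have hM : 0 < W * U := by omega
  set s := (Finset.range U).filter fun i => P (E * R * (a * U + i) / (W * U) % R) with hs
  -- F bounds the subcells sharing one value of the floor, T the values of its quotient by R. The
  -- factor 6 comes from F·E·R ≤ 2·W·U and T·W ≤ 3·E.
  set F := W * U / (E * R) + 1 with hF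
  set T := E / W + 2 with hT
  set f : ℕ → ℕ := fun i => E * R * (a * U + i) / (W * U) with hf
  have hfib : ∀ y ∈ s.image f, (s.filter fun i => f i = y).card ≤ F := by
    intro y _
    refine le_trans ?_ (card_floor_fiber_le hERp hM (s.image (a * U + ·)) y)
    refine Finset.card_le_card_of_injOn (a * U + ·) (fun i hi => ?_) fun i _ j _ h =>
      Nat.add_left_cancel h
    have hi := Finset.mem_filter.1 (Finset.mem_coe.1 hi)
    exact Finset.mem_coe.2 (Finset.mem_filter.2 ⟨Finset.mem_image_of_mem _ hi.1, hi.2⟩)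
  have himg : (s.image f).card ≤ T * ((Finset.range R).filter P).card := by
    have hsub : s.image f ⊆ (Finset.range T ×ˢ (Finset.range R).filter P).image
        fun p => (E * a / W + p.1) * R + p.2 := by
      intro y hy
      obtain ⟨i, hi, rfl⟩ := Finset.mem_image.1 hy
      obtain ⟨hiU, hiP⟩ := Finset.mem_filter.1 hi
      have hiU := Finset.mem_range.1 hiU
      have hdiv : f i / R = E * (a * U + i) / (W * U) := by
        rw [hf, Nat.div_div_eq_div_mul, show E * R * (a * U + i) = E * (a * U + i) * R by ring,
          Nat.mul_div_mul_right _ _ hR]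
      have hlow : E * a / W ≤ f i / R := by
        rw [hdiv, ← Nat.mul_div_mul_right (E * a) W (by omega : 0 < U)]
        exact Nat.div_le_div_right (by nlinarith)
      have hupp : f i / R < E * a / W + T := by
        rw [hdiv]
        refine Nat.div_lt_of_lt_mul ?_
        have h1 := Nat.lt_mul_div_succ (E * a) hW
        have h2 := Nat.lt_mul_div_succ E hW
        have h3 : E * a + E ≤ W * (E * a / W + T) := by
          rw [hT]
          nlinarith
        have h4 : E * (a * U + i) < (E * a + E) * U := by
          have : E * i < E * U := Nat.mul_lt_mul_of_pos_left hiU hE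
          nlinarith
        calc E * (a * U + i) < (E * a + E) * U := h4
          _ ≤ W * (E * a / W + T) * U := Nat.mul_le_mul_right _ h3
          _ = W * U * (E * a / W + T) := by ring
      refine Finset.mem_image.2 ⟨(f i / R - E * a / W, f i % R), Finset.mem_product.2
        ⟨Finset.mem_range.2 (by simp only; omega), Finset.mem_filter.2
          ⟨Finset.mem_range.2 (Nat.mod_lt _ hR), hiP⟩⟩, ?_⟩
      simp only
      rw [Nat.add_sub_cancel' hlow, mul_comm]
      exact Nat.div_add_mod _ _
    calc _ ≤ _ := Finset.card_le_card hsub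
      _ ≤ _ := Finset.card_image_le
      _ = _ := by rw [Finset.card_product, Finset.card_range]
  have hcard := (Finset.card_le_mul_card_image s F hfib).trans (Nat.mul_le_mul_left F himg)
  have hFT : F * T * R ≤ 6 * U := by
    have h1 : F * (E * R) ≤ 2 * (W * U) := by
      rw [hF, add_mul, one_mul]
      have := Nat.div_mul_le_self (W * U) (E * R)
      omega
    have h2 : T * W ≤ 3 * E := by
      rw [hT, add_mul]
      have := Nat.div_mul_le_self E W
      omega
    have h3 := Nat.mul_le_mul h1 h2
    have h4 : (F * T * R) * (E * W) ≤ (6 * U) * (E * W) := by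
      calc _ = F * (E * R) * (T * W) := by ring
        _ ≤ _ := h3
        _ = _ := by ring
    exact Nat.le_of_mul_le_mul_right h4 (Nat.mul_pos hE hW)
  calc s.card * R ≤ F * (T * ((Finset.range R).filter P).card) * R := Nat.mul_le_mul_right _ hcard
    _ = F * T * R * ((Finset.range R).filter P).card := by ring
    _ ≤ _ := Nat.mul_le_mul_right _ hFT

/-- All blocks of one residue class are digits, in base b^h, of a single integer below (b^h)^Q. This
is the form in which `deviation_count_le` and `equidistribution` apply. -/
theorem block_eq {b h t Q x M i : ℕ} (hb : 0 < b) (hi : i < Q) :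
    b ^ (t + h * (i + 1)) * x / M % b ^ h =
      b ^ t * (b ^ h) ^ Q * x / M % (b ^ h) ^ Q / (b ^ h) ^ (Q - 1 - i) % b ^ h := by
  have hB : 0 < b ^ h := by positivity
  set B := b ^ h with hBdef
  set y := b ^ t * B ^ Q * x / M with hy
  have hQ : B ^ Q = B ^ (i + 1) * B ^ (Q - 1 - i) := by
    rw [← pow_add]
    congr 1
    omega
  have h1 : b ^ (t + h * (i + 1)) * x / M = y / B ^ (Q - 1 - i) := by
    rw [hy, Nat.div_div_eq_div_mul, hQ, pow_add, pow_mul, ← hBdef,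
      show b ^ t * (B ^ (i + 1) * B ^ (Q - 1 - i)) * x =
        b ^ t * B ^ (i + 1) * x * B ^ (Q - 1 - i) by ring, Nat.mul_div_mul_right _ _ (by positivity)]
  rw [h1]
  conv_lhs => rw [← Nat.mod_add_div y (B ^ Q)]
  rw [show B ^ Q * (y / B ^ Q) = (B ^ i * (y / B ^ Q) * B) * B ^ (Q - 1 - i) by
    rw [hQ, pow_succ]; ring, Nat.add_mul_div_right _ _ (by positivity), Nat.add_mul_mod_self_right]

/-- The number of subcells that violate the requirement on the block `v` in `CellGood`. -/
theorem card_deviation_le {b l w s L R a W U h c v : ℕ} (hb : 2 ≤ b) (hW : 0 < W)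
    (hWs : W ≤ b ^ s) (hL : b ^ L ≤ W * U) (hLR : L ≤ R) (hh : 1 ≤ h) (hv : v < b ^ h) :
    ((Finset.range U).filter fun i => ∃ q < R + 1, s + c + h * q ≤ L ∧
      l * w * b ^ h < ((blockCount (b ^ ·) (W * U) (a * U + i) (s + c) h q v * b ^ h - q) +
        (q - blockCount (b ^ ·) (W * U) (a * U + i) (s + c) h q v * b ^ h)) * (h * h * h)).card *
      (l * w * b ^ h) ^ 4 ≤ 6 * U * (h ^ 12 * (3 * R ^ 2 * (b ^ h) ^ 2 + R * (b ^ h) ^ 3)) := by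
  classical
  set B := b ^ h with hB
  have hBp : 0 < B := by positivity
  rcases lt_or_ge L (s + c) with hlt | hge
  · rw [Finset.card_eq_zero.2 (Finset.filter_eq_empty_iff.2 fun i _ => by
      rintro ⟨q, _, hq, _⟩
      omega), zero_mul]
    exact Nat.zero_le _
  set Q := (L - (s + c)) / h with hQ
  have hQh : h * Q ≤ L - (s + c) := Nat.mul_div_le _ _
  have hQR : Q ≤ R := by nlinarith [Nat.sub_le L (s + c)]
  have hpow : b ^ (s + c) * B ^ Q ≤ W * U := by
    rw [hB, ← pow_mul, ← pow_add]
    exact (Nat.pow_le_pow_right (by omega) (by omega)).trans hL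
  -- The factor h^12 is the fourth power of the weight h³ in `CellGood`.
  let P : ℤ → Prop := fun x => (((l * w * B) ^ 4 : ℕ) : ℤ) ≤ (h ^ 12 : ℕ) * x ^ 4
  let Z : ℕ → Prop := fun z => ∃ q ≤ Q, P
      (((Finset.range q).filter fun i => z / B ^ (Q - 1 - i) % B = v).card * B - q : ℤ)
  have hdev := deviation_count_le (B := B) hv Q (w := h ^ 12) (X := (l * w * B) ^ 4) (P := P)
    fun _ hx => hx
  rw [← card_filter_eq_sum_ind _ Z] at hdev
  have hequi := equidistribution (a := a) (R := B ^ Q) hW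
    (hWs.trans (Nat.pow_le_pow_right (by omega) (Nat.le_add_right s c))) (by positivity) hpow Z
  set S := (Finset.range U).filter fun i => ∃ q < R + 1, s + c + h * q ≤ L ∧
      l * w * B < ((blockCount (b ^ ·) (W * U) (a * U + i) (s + c) h q v * B - q) +
        (q - blockCount (b ^ ·) (W * U) (a * U + i) (s + c) h q v * B)) * (h * h * h) with hS
  have hsub : S ⊆ (Finset.range U).filter fun i =>
      Z (b ^ (s + c) * B ^ Q * (a * U + i) / (W * U) % B ^ Q) := by
    intro i hi
    obtain ⟨hiU, q, hq, hqL, hlt⟩ := Finset.mem_filter.1 hi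
    have hqQ : q ≤ Q := by
      rw [hQ, Nat.le_div_iff_mul_le (by omega)]
      rw [mul_comm]
      omega
    refine Finset.mem_filter.2 ⟨hiU, q, hqQ, ?_⟩
    have hcount : ((Finset.range q).filter fun j => b ^ (s + c) * B ^ Q * (a * U + i) / (W * U) %
        B ^ Q / B ^ (Q - 1 - j) % B = v).card =
        blockCount (b ^ ·) (W * U) (a * U + i) (s + c) h q v := by
      unfold blockCount
      congr 1
      refine Finset.filter_congr fun j hj => ?_
      have := Finset.mem_range.1 hj
      rw [block_eq (by omega) (by omega : j < Q)]
    rw [hcount]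
    set C := blockCount (b ^ ·) (W * U) (a * U + i) (s + c) h q v
    have h4 := Nat.pow_le_pow_left hlt.le 4
    have habs : ((((C * B - q) + (q - C * B) : ℕ) : ℤ)) ^ 4 = ((C : ℤ) * B - q) ^ 4 := by
      rcases le_total (C * B) q with hle | hle
      · rw [Nat.sub_eq_zero_of_le hle, zero_add, Nat.cast_sub hle]
        push_cast
        ring
      · rw [Nat.sub_eq_zero_of_le hle, add_zero, Nat.cast_sub hle]
        push_cast
        ring
    change (((l * w * B) ^ 4 : ℕ) : ℤ) ≤ (h ^ 12 : ℕ) * ((C : ℤ) * B - q) ^ 4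
    rw [← habs]
    refine (Nat.cast_le.2 h4).trans (le_of_eq ?_)
    push_cast
    ring
  have h1 := (Nat.mul_le_mul_right (B ^ Q) (Finset.card_le_card hsub)).trans hequi
  refine Nat.le_of_mul_le_mul_right (c := B ^ Q) ?_ (by positivity)
  calc S.card * (l * w * B) ^ 4 * B ^ Q = S.card * B ^ Q * (l * w * B) ^ 4 := by ring
    _ ≤ 6 * U * ((Finset.range (B ^ Q)).filter Z).card * (l * w * B) ^ 4 :=
        Nat.mul_le_mul_right _ h1
    _ = 6 * U * (((Finset.range (B ^ Q)).filter Z).card * (l * w * B) ^ 4) := by ring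
    _ ≤ 6 * U * (h ^ 12 * (B ^ Q * (3 * Q ^ 2 * B ^ 2 + Q * B ^ 3))) :=
        Nat.mul_le_mul_left _ hdev
    _ ≤ 6 * U * (h ^ 12 * (B ^ Q * (3 * R ^ 2 * B ^ 2 + R * B ^ 3))) := by gcongr
    _ = _ := by ring

/-- The number of subcells that contain a `b`-adic number of level `L`. -/
theorem card_straddle_le {b k L a W U : ℕ} (hL : b ^ L * 2 ^ k ≤ W * U) (hk : 2 ^ k ≤ U)
    (hW : 0 < W) :
    ((Finset.range U).filter fun i => b ^ L * (a * U + i) / (W * U) ≠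
      b ^ L * (a * U + i + 1) / (W * U)).card * 2 ^ k ≤ 2 * U := by
  have hU : 0 < U := lt_of_lt_of_le (by positivity) hk
  have hM : 0 < W * U := Nat.mul_pos hW hU
  set f : ℕ → ℕ := fun i => b ^ L * (a * U + i) / (W * U) with hf
  have hmono : ∀ i, f i ≤ f (i + 1) := fun i =>
    Nat.div_le_div_right (Nat.mul_le_mul_left _ (by omega))
  -- A monotone integer sequence jumps at most as often as its total increase.
  have hcard : ((Finset.range U).filter fun i => f i ≠ f (i + 1)).card ≤ f U - f 0 := by
    rw [← Finset.sum_range_tsub (monotone_nat_of_le_succ hmono), Finset.card_filter]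
    refine Finset.sum_le_sum fun i _ => ?_
    have := hmono i
    split_ifs <;> omega
  have hdiff : f U ≤ f 0 + b ^ L * U / (W * U) + 1 := by
    refine Nat.lt_succ_iff.1 (Nat.div_lt_of_lt_mul ?_)
    have h1 := Nat.lt_mul_div_succ (b ^ L * (a * U + 0)) hM
    have h2 := Nat.lt_mul_div_succ (b ^ L * U) hM
    have h3 : f 0 = b ^ L * (a * U + 0) / (W * U) := rfl
    rw [h3]
    nlinarith
  have hfrac : b ^ L * U / (W * U) * 2 ^ k ≤ U := by
    rw [Nat.mul_div_mul_right _ _ hU]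
    refine Nat.le_of_mul_le_mul_right (c := W) ?_ hW
    calc b ^ L / W * 2 ^ k * W = b ^ L / W * W * 2 ^ k := by ring
      _ ≤ b ^ L * 2 ^ k := Nat.mul_le_mul_right _ (Nat.div_mul_le_self _ _)
      _ ≤ U * W := by rwa [mul_comm U]
  have : f U - f 0 ≤ b ^ L * U / (W * U) + 1 :=
    Nat.sub_le_iff_le_add.2 (by linarith)
  calc _ ≤ (b ^ L * U / (W * U) + 1) * 2 ^ k := Nat.mul_le_mul_right _ (hcard.trans this)
    _ ≤ 2 * U := by rw [add_mul]; omega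

theorem summable_pow_div_two_pow (n : ℕ) : Summable fun h : ℕ => (h : ℝ) ^ n / 2 ^ h := by
  have := summable_pow_mul_geometric_of_norm_lt_one n (r := (1 / 2 : ℝ)) (by norm_num)
  refine this.congr fun h => ?_
  rw [one_div, inv_pow, div_eq_mul_inv]

open Classical in
/-- The number of subcells of a cell that are bad for a single base. -/
theorem card_not_cellGood_le {b k l s L a W U : ℕ} (hb : 2 ≤ b) (hl : 1 ≤ l) (hW : 0 < W)
    (hWs : W ≤ b ^ s) (hL : b ^ L * 2 ^ k ≤ W * U) (hLR : L ≤ 4 ^ (k + 1)) (hk : 2 ^ k ≤ U) :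
    (((Finset.range U).filter fun i =>
      ¬CellGood (b ^ ·) k l (2 ^ k) s L (W * U) (4 ^ (k + 1)) (a * U + i)).card : ℝ) ≤
      U * (2 / 2 ^ k + 312 * (∑' h : ℕ, (h : ℝ) ^ 13 / 2 ^ h) / l) := by
  set R := 4 ^ (k + 1) with hR
  set St := (Finset.range U).filter fun i => b ^ L * (a * U + i) / (W * U) ≠
      b ^ L * (a * U + i + 1) / (W * U) with hSt
  let Dev : ℕ → ℕ → ℕ → Finset ℕ := fun h c v =>
    (Finset.range U).filter fun i => ∃ q < R + 1, s + c + h * q ≤ L ∧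
      l * 2 ^ k * b ^ h < ((blockCount (b ^ ·) (W * U) (a * U + i) (s + c) h q v * b ^ h - q) +
        (q - blockCount (b ^ ·) (W * U) (a * U + i) (s + c) h q v * b ^ h)) * (h * h * h)
  have hL' : b ^ L ≤ W * U := le_trans (Nat.le_mul_of_pos_right _ (by positivity)) hL
  have hsub : ((Finset.range U).filter fun i =>
      ¬CellGood (b ^ ·) k l (2 ^ k) s L (W * U) R (a * U + i)) ⊆
      St ∪ (Finset.Icc 1 k).biUnion fun h => (Finset.range h).biUnion fun c =>
        (Finset.range (b ^ h)).biUnion fun v => Dev h c v := by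
    intro i hi
    obtain ⟨hiU, hbad⟩ := Finset.mem_filter.1 hi
    by_contra hnot
    rw [Finset.mem_union, not_or] at hnot
    obtain ⟨h1, h2⟩ := hnot
    refine hbad ⟨?_, fun h hh hh1 c hc q hq hqL v hv => ?_⟩
    · by_contra hne
      exact h1 (Finset.mem_filter.2 ⟨hiU, hne⟩)
    · by_contra hlt
      refine h2 (Finset.mem_biUnion.2 ⟨h, Finset.mem_Icc.2 ⟨hh1, by omega⟩,
        Finset.mem_biUnion.2 ⟨c, Finset.mem_range.2 hc, Finset.mem_biUnion.2 ⟨v,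
          Finset.mem_range.2 hv, Finset.mem_filter.2 ⟨hiU, q, hq, hqL, not_le.1 hlt⟩⟩⟩⟩)
  have hcard : (((Finset.range U).filter fun i =>
      ¬CellGood (b ^ ·) k l (2 ^ k) s L (W * U) R (a * U + i)).card : ℝ) ≤
      St.card + ∑ h ∈ Finset.Icc 1 k, ∑ c ∈ Finset.range h, ∑ v ∈ Finset.range (b ^ h),
        ((Dev h c v).card : ℝ) := by
    refine (Nat.cast_le.2 ((Finset.card_le_card hsub).trans (Finset.card_union_le _ _))).trans ?_
    rw [Nat.cast_add]
    refine add_le_add le_rfl ?_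
    refine (Nat.cast_le.2 (Finset.card_biUnion_le.trans (Finset.sum_le_sum fun h _ =>
      Finset.card_biUnion_le.trans (Finset.sum_le_sum fun c _ => Finset.card_biUnion_le)))).trans ?_
    push_cast
    exact le_rfl
  refine hcard.trans ?_
  rw [mul_add]
  refine add_le_add ?_ ?_
  · have := card_straddle_le (a := a) hL hk hW
    have h2 : (St.card : ℝ) * 2 ^ k ≤ 2 * U := by exact_mod_cast this
    rw [mul_div_assoc', le_div_iff₀ (by positivity)]
    linarith
  · have hl0 : (1 : ℝ) ≤ l := by exact_mod_cast hl
    have hterm : ∀ h ∈ Finset.Icc 1 k, ∑ c ∈ Finset.range h, ∑ v ∈ Finset.range (b ^ h),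
        ((Dev h c v).card : ℝ) ≤ U * (312 / l) * ((h : ℝ) ^ 13 / 2 ^ h) := by
      intro h hh
      obtain ⟨hh1, hhk⟩ := Finset.mem_Icc.1 hh
      set B : ℝ := (b : ℝ) ^ h with hB
      have hB2 : (2 : ℝ) ^ h ≤ B := pow_le_pow_left₀ (by norm_num) (by exact_mod_cast hb) h
      have hBp : 0 < B := lt_of_lt_of_le (by positivity) hB2
      have h2p : (0 : ℝ) < 2 ^ h := by positivity
      set w : ℝ := (2 : ℝ) ^ k with hw
      have hwp : 0 < w := by positivity
      have hw1 : 1 ≤ w := one_le_pow₀ (by norm_num)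
      have hwh : (2 : ℝ) ^ h ≤ w := pow_le_pow_right₀ (by norm_num) hhk
      have hdev : ∀ c v, v < b ^ h → ((Dev h c v).card : ℝ) ≤
          U * h ^ 12 * 312 / (l * B * 2 ^ h) := by
        intro c v hv
        have h1 := card_deviation_le (a := a) (c := c) (w := 2 ^ k) (l := l) hb hW hWs hL' hLR
          hh1 hv
        have hRw : (R : ℝ) = 4 * w ^ 2 := by
          rw [hR, hw, ← pow_mul, mul_comm k 2, pow_mul]
          push_cast
          rw [pow_succ]
          norm_num [mul_comm]
        have h2 : ((Dev h c v).card : ℝ) * (l * w * B) ^ 4 ≤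
            6 * U * (h ^ 12 * (3 * R ^ 2 * B ^ 2 + R * B ^ 3)) := by
          have := (Nat.cast_le (α := ℝ)).2 h1
          push_cast at this
          exact this
        rw [hRw] at h2
        have hl4 : (l : ℝ) ≤ l ^ 4 := le_self_pow₀ hl0 (by norm_num)
        -- Since R = 4w², the coefficients are 288 and 24, with sum 312. The factor 2^h is absorbed
        -- by B in the first term and by w² in the second; it makes the sum over h converge.
        have hkey : (6 * (3 * (4 * w ^ 2) ^ 2 * B ^ 2 + 4 * w ^ 2 * B ^ 3)) * 2 ^ h ≤
            312 * w ^ 4 * B ^ 3 := by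
          have e1 : w ^ 4 * B ^ 2 * 2 ^ h ≤ w ^ 4 * B ^ 2 * B :=
            mul_le_mul_of_nonneg_left hB2 (by positivity)
          have e2 : w ^ 2 * B ^ 3 * 2 ^ h ≤ w ^ 2 * B ^ 3 * w ^ 2 :=
            mul_le_mul_of_nonneg_left (hwh.trans (le_self_pow₀ hw1 (by norm_num))) (by positivity)
          nlinarith
        rw [le_div_iff₀ (by positivity)]
        have h3 : ((Dev h c v).card : ℝ) * (l * B * 2 ^ h) * (w ^ 4 * B ^ 3) ≤
            U * h ^ 12 * 312 * (w ^ 4 * B ^ 3) := by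
          calc _ = ((Dev h c v).card : ℝ) * l * (w ^ 4 * B ^ 4) * 2 ^ h := by ring
            _ ≤ ((Dev h c v).card : ℝ) * l ^ 4 * (w ^ 4 * B ^ 4) * 2 ^ h := by gcongr
            _ = (((Dev h c v).card : ℝ) * (l * w * B) ^ 4) * 2 ^ h := by ring
            _ ≤ (6 * U * (h ^ 12 * (3 * (4 * w ^ 2) ^ 2 * B ^ 2 + 4 * w ^ 2 * B ^ 3))) * 2 ^ h := by
                gcongr
            _ = U * h ^ 12 * ((6 * (3 * (4 * w ^ 2) ^ 2 * B ^ 2 + 4 * w ^ 2 * B ^ 3)) * 2 ^ h) := by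
                ring
            _ ≤ U * h ^ 12 * (312 * w ^ 4 * B ^ 3) := by gcongr
            _ = _ := by ring
        exact le_of_mul_le_mul_right h3 (by positivity)
      calc ∑ c ∈ Finset.range h, ∑ v ∈ Finset.range (b ^ h), ((Dev h c v).card : ℝ)
          ≤ ∑ c ∈ Finset.range h, ∑ v ∈ Finset.range (b ^ h),
            U * (h : ℝ) ^ 12 * 312 / (l * B * 2 ^ h) :=
          Finset.sum_le_sum fun c _ => Finset.sum_le_sum fun v hv =>
            hdev c v (Finset.mem_range.1 hv)
        _ = h * (B * (U * h ^ 12 * 312 / (l * B * 2 ^ h))) := by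
            simp only [Finset.sum_const, Finset.card_range, nsmul_eq_mul, hB]
            push_cast
            ring
        _ = U * (312 / l) * (h ^ 13 / 2 ^ h) := by
            field_simp
    calc _ ≤ ∑ h ∈ Finset.Icc 1 k, U * (312 / l) * ((h : ℝ) ^ 13 / 2 ^ h) :=
          Finset.sum_le_sum hterm
      _ = U * (312 / l) * ∑ h ∈ Finset.Icc 1 k, (h : ℝ) ^ 13 / 2 ^ h := by rw [Finset.mul_sum]
      _ ≤ U * (312 / l) * ∑' h : ℕ, (h : ℝ) ^ 13 / 2 ^ h := by
          refine mul_le_mul_of_nonneg_left ?_ (by positivity)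
          exact (summable_pow_div_two_pow 13).sum_le_tsum _ fun h _ => by positivity
      _ = _ := by ring

/-! ### The digit windows of a stage and the choice of K -/

theorem two_pow_le_pow_startPos {b : ℕ} (hb : 2 ≤ b) (k : ℕ) :
    2 ^ 4 ^ k ≤ b ^ startPos (· ^ ·) b k := by
  rw [startPos_eq hb]
  exact (Nat.lt_pow_succ_log_self (by omega) _).le

/-- Giving up the last k digits makes the b-adic spacing at least 2^k cells wide, so that few
subcells straddle a b-adic number. -/
theorem pow_endPos_mul_le {b : ℕ} (hb : 2 ≤ b) (k : ℕ) :
    b ^ endPos (· ^ ·) b k * 2 ^ k ≤ 2 ^ 4 ^ (k + 1) := by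
  rw [endPos_eq hb]
  rcases le_total k (Nat.log b (2 ^ 4 ^ (k + 1))) with h | h
  · calc _ ≤ b ^ (Nat.log b (2 ^ 4 ^ (k + 1)) - k) * b ^ k :=
          Nat.mul_le_mul_left _ (Nat.pow_le_pow_left hb k)
      _ = b ^ Nat.log b (2 ^ 4 ^ (k + 1)) := by rw [← pow_add, Nat.sub_add_cancel h]
      _ ≤ _ := Nat.pow_log_le_self _ (by positivity)
  · rw [Nat.sub_eq_zero_of_le h, pow_zero, one_mul]
    have := succ_le_four_pow k
    exact Nat.pow_le_pow_right (by norm_num) (by omega)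

theorem two_pow_cells (k : ℕ) : 2 ^ 4 ^ k * 2 ^ (4 ^ (k + 1) - 4 ^ k) = 2 ^ 4 ^ (k + 1) := by
  rw [← pow_add, Nat.add_sub_cancel' (Nat.pow_le_pow_right (by norm_num) (by omega))]

theorem exists_stageGood : ∃ K : ℕ, ∀ k a, ∃ i < 2 ^ (4 ^ (k + 1) - 4 ^ k),
    StageGood (· ^ ·) K k (a * 2 ^ (4 ^ (k + 1) - 4 ^ k) + i) := by
  classical
  set K₁ : ℝ := 312 * ∑' h : ℕ, (h : ℝ) ^ 13 / 2 ^ h with hK₁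
  have hK₁0 : 0 ≤ K₁ := mul_nonneg (by norm_num) (tsum_nonneg fun h => by positivity)
  -- At most l/K bases are active, each with a bad fraction of at most (2 + K₁)/l, so any K > 2 + K₁
  -- leaves a good subcell.
  obtain ⟨K, hK⟩ := exists_nat_ge (K₁ + 3)
  have hKp : (0 : ℝ) < K := by linarith
  refine ⟨K, fun k a => ?_⟩
  set U := 2 ^ (4 ^ (k + 1) - 4 ^ k) with hU
  set l := logLog (· ^ ·) k with hl
  have hUp : (0 : ℝ) < U := by rw [hU]; positivity
  have hkU : 2 ^ k ≤ U := by
    refine Nat.pow_le_pow_right (by norm_num) ?_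
    have : k < 4 ^ k := Nat.lt_pow_self (by norm_num)
    rw [pow_succ]
    omega
  by_contra! hbad
  set act := (Finset.range k).filter fun b => 2 ≤ b ∧ K * b ≤ l with hact
  let Bad : ℕ → Finset ℕ := fun b => (Finset.range U).filter fun i =>
    ¬CellGood (b ^ ·) k l (2 ^ k) (startPos (· ^ ·) b k) (endPos (· ^ ·) b k)
      (2 ^ 4 ^ k * U) (4 ^ (k + 1)) (a * U + i)
  have hcover : Finset.range U ⊆ act.biUnion Bad := by
    intro i hi
    have h := hbad i (Finset.mem_range.1 hi)
    unfold StageGood at h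
    push Not at h
    obtain ⟨b, hbk, hb2, hKb, hcell⟩ := h
    refine Finset.mem_biUnion.2 ⟨b, Finset.mem_filter.2 ⟨Finset.mem_range.2 hbk, hb2, hKb⟩,
      Finset.mem_filter.2 ⟨hi, ?_⟩⟩
    rw [two_pow_cells]
    exact hcell
  have hBad : ∀ b ∈ act, ((Bad b).card : ℝ) ≤ U * (2 / 2 ^ k + K₁ / l) := by
    intro b hb
    obtain ⟨_, hb2, hKb⟩ := Finset.mem_filter.1 hb
    have hl1 : 1 ≤ l := by
      have : 0 < K := by exact_mod_cast hKp
      nlinarith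
    exact card_not_cellGood_le hb2 hl1 (by positivity) (two_pow_le_pow_startPos hb2 k)
      (by rw [two_pow_cells]; exact pow_endPos_mul_le hb2 k)
      ((Nat.sub_le _ _).trans (logCount_le _ _ _)) hkU
  have hsum : (U : ℝ) ≤ act.card * (U * (2 / 2 ^ k + K₁ / l)) := by
    have h1 : U ≤ ∑ b ∈ act, (Bad b).card := by
      simpa using (Finset.card_le_card hcover).trans Finset.card_biUnion_le
    calc (U : ℝ) ≤ ∑ b ∈ act, ((Bad b).card : ℝ) := by exact_mod_cast h1
      _ ≤ ∑ b ∈ act, U * (2 / 2 ^ k + K₁ / l) := Finset.sum_le_sum hBad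
      _ = _ := by rw [Finset.sum_const, nsmul_eq_mul]
  have hcard : act.card * K ≤ l := by
    rw [← Nat.le_div_iff_mul_le (by exact_mod_cast hKp)]
    have hs : act ⊆ Finset.Icc 1 (l / K) := by
      intro b hb
      obtain ⟨_, hb2, hKb⟩ := Finset.mem_filter.1 hb
      rw [Finset.mem_Icc, Nat.le_div_iff_mul_le (by exact_mod_cast hKp), mul_comm b]
      exact ⟨by omega, hKb⟩
    simpa using Finset.card_le_card hs
  have hlk : (l : ℝ) ≤ 2 ^ k := by
    have h1 : l ≤ k := (logCount_le _ _ _).trans (logCount_le _ _ _)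
    exact_mod_cast h1.trans Nat.lt_two_pow_self.le
  have hcardR : (act.card : ℝ) * K ≤ l := by exact_mod_cast hcard
  -- If l = 0, no base is active and there is nothing to test.
  rcases Nat.eq_zero_or_pos l with hl0 | hl0
  · have : act.card = 0 := by
      have h0 : 0 < K := by exact_mod_cast hKp
      rw [hl0] at hcard
      nlinarith
    rw [this] at hsum
    simp only [Nat.cast_zero, zero_mul] at hsum
    linarith
  have hlp : (0 : ℝ) < l := by exact_mod_cast hl0
  have h2k : (0 : ℝ) < 2 ^ k := by positivity
  have h1 : (1 : ℝ) ≤ act.card * (2 / 2 ^ k + K₁ / l) := by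
    refine le_of_mul_le_mul_left ?_ hUp
    calc (U : ℝ) * 1 ≤ act.card * (U * (2 / 2 ^ k + K₁ / l)) := by rw [mul_one]; exact hsum
      _ = _ := by ring
  have h2 : 2 / 2 ^ k + K₁ / l ≤ (2 + K₁) / l := by
    rw [add_div]
    gcongr
  have h3 : (act.card : ℝ) * ((2 + K₁) / l) * K ≤ 2 + K₁ := by
    calc _ = (act.card * K) * ((2 + K₁) / l) := by ring
      _ ≤ l * ((2 + K₁) / l) := by gcongr
      _ = 2 + K₁ := by field_simp
  have h4 : (act.card : ℝ) * (2 / 2 ^ k + K₁ / l) ≤ act.card * ((2 + K₁) / l) := by gcongr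
  have h5 : 1 * (K : ℝ) ≤ act.card * ((2 + K₁) / l) * K :=
    mul_le_mul_of_nonneg_right (h1.trans h4) hKp.le
  linarith

/-! ### The limit -/

/-- The cells of the stages, without cap. -/
noncomputable def cellSeq (K n : ℕ) : ℕ := Nat.rec 0 (fun k a => child (· ^ ·) K k a) n

/-- The existence of good subcells at all stages. -/
def GoodSubcells (K : ℕ) : Prop := ∀ k a, ∃ i < 2 ^ (4 ^ (k + 1) - 4 ^ k),
  StageGood (· ^ ·) K k (a * 2 ^ (4 ^ (k + 1) - 4 ^ k) + i)

namespace GoodSubcells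

variable {K : ℕ} (hK : GoodSubcells K)
include hK

theorem cellSeq_succ (k : ℕ) : ∃ i < 2 ^ (4 ^ (k + 1) - 4 ^ k),
    cellSeq K (k + 1) = cellSeq K k * 2 ^ (4 ^ (k + 1) - 4 ^ k) + i ∧
      StageGood (· ^ ·) K k (cellSeq K (k + 1)) := by
  obtain ⟨h1, h2⟩ := firstIndex_spec (hK k (cellSeq K k))
  exact ⟨_, h1, rfl, h2⟩

theorem cellSeq_lt (k : ℕ) : cellSeq K k < 2 ^ 4 ^ k := by
  induction k with
  | zero => exact Nat.pow_pos (by norm_num)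
  | succ k ih =>
    obtain ⟨i, hi, h, -⟩ := hK.cellSeq_succ k
    rw [h, ← two_pow_cells]
    calc _ < cellSeq K k * 2 ^ (4 ^ (k + 1) - 4 ^ k) + 2 ^ (4 ^ (k + 1) - 4 ^ k) := by omega
      _ = (cellSeq K k + 1) * 2 ^ (4 ^ (k + 1) - 4 ^ k) := by ring
      _ ≤ _ := Nat.mul_le_mul_right _ ih

theorem stage_eq {V n : ℕ} (hV : 2 ^ 4 ^ n ≤ V) : stage (· ^ ·) V K n = cellSeq K n := by
  induction n with
  | zero => rfl
  | succ n ih =>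
    have h4 : 2 ^ 4 ^ n ≤ 2 ^ 4 ^ (n + 1) :=
      Nat.pow_le_pow_right (by norm_num) (Nat.pow_le_pow_right (by norm_num) (by omega))
    change min (child (· ^ ·) K n (stage (· ^ ·) V K n)) V = cellSeq K (n + 1)
    rw [ih (h4.trans hV)]
    exact min_eq_left ((hK.cellSeq_lt (n + 1)).le.trans hV)

theorem cell_nested (k : ℕ) :
    (cellSeq K k : ℝ) / 2 ^ 4 ^ k ≤ cellSeq K (k + 1) / 2 ^ 4 ^ (k + 1) ∧
      ((cellSeq K (k + 1) : ℝ) + 1) / 2 ^ 4 ^ (k + 1) ≤ (cellSeq K k + 1) / 2 ^ 4 ^ k := by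
  obtain ⟨i, hi, h, -⟩ := hK.cellSeq_succ k
  have hU := two_pow_cells k
  set U := 2 ^ (4 ^ (k + 1) - 4 ^ k) with hUdef
  have hUp : (0 : ℝ) < U := by rw [hUdef]; positivity
  have hUR : (2 : ℝ) ^ 4 ^ (k + 1) = 2 ^ 4 ^ k * U := by exact_mod_cast hU.symm
  have hiU : (i : ℝ) + 1 ≤ U := by exact_mod_cast hi
  have hW : (0 : ℝ) < 2 ^ 4 ^ k := by positivity
  rw [hUR, h]
  push_cast
  constructor
  · rw [div_le_div_iff₀ hW (by positivity)]
    have : 0 ≤ (i : ℝ) * 2 ^ 4 ^ k := by positivity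
    linarith
  · rw [div_le_div_iff₀ (by positivity) hW]
    have := mul_le_mul_of_nonneg_right hiU hW.le
    linarith

/-- The supremum of the left endpoints works. The cells are closed, so a right endpoint is not
excluded here; the first clause of `CellGood` covers that case later. -/
theorem exists_limit : ∃ x : ℝ, ∀ k,
    (cellSeq K k : ℝ) / 2 ^ 4 ^ k ≤ x ∧ x ≤ (cellSeq K k + 1) / 2 ^ 4 ^ k := by
  have hmono := monotone_nat_of_le_succ (f := fun k => (cellSeq K k : ℝ) / 2 ^ 4 ^ k)
    fun k => (hK.cell_nested k).1
  have hanti := antitone_nat_of_succ_le (f := fun k => ((cellSeq K k : ℝ) + 1) / 2 ^ 4 ^ k)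
    fun k => (hK.cell_nested k).2
  have hle : ∀ j k, (cellSeq K j : ℝ) / 2 ^ 4 ^ j ≤ (cellSeq K k + 1) / 2 ^ 4 ^ k := by
    intro j k
    calc (cellSeq K j : ℝ) / 2 ^ 4 ^ j ≤ cellSeq K (max j k) / 2 ^ 4 ^ (max j k) :=
          hmono (le_max_left j k)
      _ ≤ (cellSeq K (max j k) + 1) / 2 ^ 4 ^ (max j k) := by gcongr; linarith
      _ ≤ _ := hanti (le_max_right j k)
  refine ⟨⨆ j, (cellSeq K j : ℝ) / 2 ^ 4 ^ j, fun k => ⟨?_, ciSup_le fun j => hle j k⟩⟩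
  exact le_ciSup (f := fun j => (cellSeq K j : ℝ) / 2 ^ 4 ^ j)
    ⟨_, by rintro _ ⟨j, rfl⟩; exact hle j k⟩ k

end GoodSubcells

/-- `x` lies in all the cells of the construction. -/
def IsLimit (K : ℕ) (x : ℝ) : Prop := ∀ k,
  (cellSeq K k : ℝ) / 2 ^ 4 ^ k ≤ x ∧ x ≤ (cellSeq K k + 1) / 2 ^ 4 ^ k

/-- Equal floors at both endpoints squeeze the floor at level L on the whole closed cell; coarser
levels follow by integer division. -/
theorem floor_pow_mul_eq {b L A M : ℕ} {x : ℝ} (hb : 0 < b) (hM : 0 < M) (h1 : (A : ℝ) / M ≤ x)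
    (h2 : x ≤ (A + 1) / M) (h : b ^ L * A / M = b ^ L * (A + 1) / M) {e : ℕ} (he : e ≤ L) :
    ⌊(b : ℝ) ^ e * x⌋₊ = b ^ e * A / M := by
  have hMR : (0 : ℝ) < M := by exact_mod_cast hM
  have hbR : (0 : ℝ) < b := by exact_mod_cast hb
  have hL : ⌊(b : ℝ) ^ L * x⌋₊ = b ^ L * A / M := by
    refine le_antisymm ?_ ?_
    · rw [h, ← Nat.floor_div_eq_div (K := ℝ)]
      refine Nat.floor_le_floor ?_
      push_cast
      rw [mul_div_assoc]
      gcongr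
    · rw [← Nat.floor_div_eq_div (K := ℝ)]
      refine Nat.floor_le_floor ?_
      push_cast
      rw [mul_div_assoc]
      gcongr
  have hbL : b ^ L = b ^ e * b ^ (L - e) := by rw [← pow_add, Nat.add_sub_cancel' he]
  have hx : (b : ℝ) ^ e * x = (b : ℝ) ^ L * x / (b ^ (L - e) : ℕ) := by
    rw [eq_div_iff (by positivity)]
    have : (b : ℝ) ^ L = b ^ e * b ^ (L - e) := by exact_mod_cast hbL
    rw [this]
    push_cast
    ring
  rw [hx, Nat.floor_div_natCast, hL, Nat.div_div_eq_div_mul, hbL,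
    show b ^ e * b ^ (L - e) * A = b ^ e * A * b ^ (L - e) by ring,
    Nat.mul_div_mul_right _ _ (by positivity)]

/-- The base `b` is active at stage `k`. -/
def IsActive (K b k : ℕ) : Prop := b < k ∧ K * b ≤ logLog (· ^ ·) k

theorem tendsto_logLog : Tendsto (logLog (· ^ ·)) atTop atTop := by
  have h : Tendsto (Nat.log 2) atTop atTop :=
    tendsto_atTop_atTop.2 fun b => ⟨2 ^ b, fun a ha => Nat.le_log_of_pow_le (by norm_num) ha⟩
  exact (h.comp h).congr fun k => (logLog_eq k).symm

theorem eventually_isActive (K b : ℕ) : ∀ᶠ k in atTop, IsActive K b k :=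
  (eventually_gt_atTop b).and (tendsto_logLog.eventually_ge_atTop _)

namespace IsLimit

variable {K : ℕ} {x : ℝ}

theorem cellGood (hK : GoodSubcells K) {b k : ℕ} (hb : 2 ≤ b) (hbk : IsActive K b k) :
    CellGood (b ^ ·) k (logLog (· ^ ·) k) (2 ^ k) (startPos (· ^ ·) b k) (endPos (· ^ ·) b k)
      (2 ^ 4 ^ (k + 1)) (4 ^ (k + 1)) (cellSeq K (k + 1)) := by
  obtain ⟨i, -, -, h⟩ := hK.cellSeq_succ k
  exact h b hbk.1 hb hbk.2

theorem floor_eq (hx : IsLimit K x) (hK : GoodSubcells K) {b k e : ℕ} (hb : 2 ≤ b)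
    (hbk : IsActive K b k) (he : e ≤ endPos (· ^ ·) b k) :
    ⌊(b : ℝ) ^ e * x⌋₊ = b ^ e * cellSeq K (k + 1) / 2 ^ 4 ^ (k + 1) := by
  have h := hx (k + 1)
  refine floor_pow_mul_eq (by omega) (by positivity) ?_ ?_ (cellGood hK hb hbk).1 he
  · exact_mod_cast h.1
  · exact_mod_cast h.2

theorem nonneg (hx : IsLimit K x) : 0 ≤ x :=
  le_trans (by positivity) (hx 0).1

/-- The closed cells alone only give x ≤ 1. At a stage where base 2 is active, the integer part is
constant on the closed cell. -/
theorem lt_one (hx : IsLimit K x) (hK : GoodSubcells K) : x < 1 := by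
  obtain ⟨k, hk⟩ := (eventually_isActive K 2).exists
  have h := hx.floor_eq hK le_rfl hk (Nat.zero_le _)
  rw [pow_zero, one_mul, pow_zero, one_mul, Nat.div_eq_of_lt (hK.cellSeq_lt _),
    Nat.floor_eq_zero] at h
  exact h

theorem endPos_two (k : ℕ) : endPos (· ^ ·) 2 k = 4 ^ (k + 1) - k := by
  rw [endPos_eq le_rfl, Nat.log_pow (by norm_num)]

theorem cellSeq_div (hK : GoodSubcells K) {k m : ℕ} (h : k ≤ m) :
    cellSeq K m / 2 ^ (4 ^ m - 4 ^ k) = cellSeq K k := by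
  induction m, h using Nat.le_induction with
  | base => simp
  | succ m hm ih =>
    obtain ⟨i, hi, h, -⟩ := hK.cellSeq_succ m
    have h1 : 4 ^ k ≤ 4 ^ m := Nat.pow_le_pow_right (by norm_num) hm
    have h2 : 4 ^ m ≤ 4 ^ (m + 1) := Nat.pow_le_pow_right (by norm_num) (by omega)
    rw [show 4 ^ (m + 1) - 4 ^ k = (4 ^ (m + 1) - 4 ^ m) + (4 ^ m - 4 ^ k) by omega, pow_add,
      ← Nat.div_div_eq_div_mul, h, add_comm, Nat.add_mul_div_right _ _ (by positivity),
      Nat.div_eq_of_lt hi, zero_add, ih]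

/-- The digits that the program outputs are the binary digits of the limit. -/
theorem digits_eq (hx : IsLimit K x) (hK : GoodSubcells K) (n : ℕ) :
    (Real.digits x 2 n : ℕ) = stageDigit (· ^ ·) (powBound n) K n := by
  have hn : n + 1 ≤ 4 ^ n := Nat.lt_pow_self (by norm_num)
  have hV : 2 ^ 4 ^ n ≤ powBound n := by
    refine Nat.pow_le_pow_right (by norm_num) ?_
    rw [show (4 : ℕ) = 2 ^ 2 by norm_num, ← pow_mul]
    exact Nat.pow_le_pow_right (by norm_num) (by omega)
  -- The closed cell of stage n need not determine the digit. A later stage with base 2 active does,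
  -- and `cellSeq_div` leads back to stage n.
  obtain ⟨k, hk, hkn⟩ := ((eventually_isActive K 2).and (eventually_ge_atTop n)).exists
  have h4 : 4 ^ n ≤ 4 ^ k := Nat.pow_le_pow_right (by norm_num) hkn
  have hkk : k < 4 ^ k := Nat.lt_pow_self (by norm_num)
  have h4k : 4 ^ (k + 1) = 4 * 4 ^ k := by rw [pow_succ]; ring
  have h := hx.floor_eq hK (e := n + 1) le_rfl hk (by rw [endPos_two]; omega)
  unfold stageDigit
  rw [hK.stage_eq hV, ← cellSeq_div hK (by omega : n ≤ k + 1), Nat.div_div_eq_div_mul, ← pow_add,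
    show 4 ^ (k + 1) - 4 ^ n + (4 ^ n - (n + 1)) = 4 ^ (k + 1) - (n + 1) by omega]
  have hdiv : cellSeq K (k + 1) / 2 ^ (4 ^ (k + 1) - (n + 1)) =
      2 ^ (n + 1) * cellSeq K (k + 1) / 2 ^ 4 ^ (k + 1) := by
    rw [show 2 ^ 4 ^ (k + 1) = 2 ^ (n + 1) * 2 ^ (4 ^ (k + 1) - (n + 1)) by
      rw [← pow_add]; congr 1; omega, Nat.mul_div_mul_left _ _ (by positivity)]
  rw [hdiv, ← h]
  simp [Real.digits, mul_comm]

end IsLimit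

/-! ### From block counts to discrepancy -/

/-- The quotient is the number of j < n in the class of c mod h. The identity reduces overlapping
blocks to disjoint ones. -/
theorem sum_range_eq_sum_classes {h : ℕ} (hh : 0 < h) (f : ℕ → ℕ) (n : ℕ) :
    ∑ j ∈ Finset.range n, f j =
      ∑ c ∈ Finset.range h, ∑ i ∈ Finset.range ((n + h - 1 - c) / h), f (c + h * i) := by
  induction n with
  | zero =>
    rw [Finset.sum_range_zero, Finset.sum_eq_zero]
    intro c hc
    rw [Nat.div_eq_of_lt (by omega), Finset.sum_range_zero]
  | succ n ih =>
    have hstep : ∀ c ∈ Finset.range h,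
        ∑ i ∈ Finset.range ((n + 1 + h - 1 - c) / h), f (c + h * i) =
        ∑ i ∈ Finset.range ((n + h - 1 - c) / h), f (c + h * i) +
          if c = n % h then f n else 0 := by
      intro c hc
      have hc := Finset.mem_range.1 hc
      have hdiv : h ∣ n + h - 1 - c + 1 ↔ c = n % h := by
        constructor
        · rintro ⟨t, ht⟩
          have : n + h = c + h * t := by omega
          rw [← Nat.add_mod_right, this, Nat.add_mul_mod_self_left, Nat.mod_eq_of_lt hc]
        · intro h'
          refine ⟨n / h + 1, ?_⟩
          have := Nat.div_add_mod n h
          rw [mul_add]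
          omega
      rw [show n + 1 + h - 1 - c = (n + h - 1 - c) + 1 by omega, Nat.succ_div]
      by_cases hcn : c = n % h
      · rw [if_pos (hdiv.2 hcn), if_pos hcn, Finset.sum_range_succ]
        congr 2
        have hq : (n + h - 1 - c) / h = n / h := by
          have := Nat.div_add_mod n h
          rw [show n + h - 1 - c = (h - 1) + h * (n / h) by omega, Nat.add_mul_div_left _ _ hh,
            Nat.div_eq_of_lt (by omega), zero_add]
        rw [hq, hcn, Nat.mod_add_div]
      · rw [if_neg (fun h' => hcn (hdiv.1 h')), if_neg hcn, add_zero, add_zero]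
    rw [Finset.sum_congr rfl hstep, Finset.sum_add_distrib, ← ih, Finset.sum_ite_eq',
      if_pos (Finset.mem_range.2 (Nat.mod_lt _ hh)), Finset.sum_range_succ]

/-- The number whose base-`b` digits are the `h` digits of `x` with the indices `j, …, j + h - 1`. -/
noncomputable def block (b : ℕ) (x : ℝ) (h j : ℕ) : ℕ := ⌊(b : ℝ) ^ (j + h) * x⌋₊ % b ^ h

section block

variable {b : ℕ} {x : ℝ}

theorem floor_mul_fract (hb : 0 < b) (hx : 0 ≤ x) (h j : ℕ) :
    ⌊(b : ℝ) ^ h * Int.fract ((b : ℝ) ^ j * x)⌋₊ = block b x h j := by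
  unfold block
  set y := (b : ℝ) ^ j * x with hy
  have hy0 : 0 ≤ y := by positivity
  have hbh : (0 : ℝ) < (b : ℝ) ^ h := by positivity
  have hfl : y = (⌊y⌋₊ : ℝ) + Int.fract y := by
    rw [natCast_floor_eq_intCast_floor hy0, Int.floor_add_fract]
  have hsplit : (b : ℝ) ^ (j + h) * x = b ^ h * Int.fract y + (b ^ h * ⌊y⌋₊ : ℕ) := by
    rw [pow_add, mul_right_comm, ← hy]
    push_cast
    rw [mul_comm, ← mul_add]
    congr 1
    linarith
  rw [hsplit, Nat.floor_add_natCast (mul_nonneg hbh.le (Int.fract_nonneg _)),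
    Nat.add_mul_mod_self_left, Nat.mod_eq_of_lt]
  rw [Nat.floor_lt (mul_nonneg hbh.le (Int.fract_nonneg _))]
  push_cast
  have := mul_lt_mul_of_pos_left (Int.fract_lt_one y) hbh
  rwa [mul_one] at this

theorem block_lt (hb : 0 < b) (h j : ℕ) : block b x h j < b ^ h :=
  Nat.mod_lt _ (by positivity)

theorem floor_pow_succ_div (hb : 0 < b) (m : ℕ) :
    ⌊(b : ℝ) ^ (m + 1) * x⌋₊ / b = ⌊(b : ℝ) ^ m * x⌋₊ := by
  rw [← Nat.floor_div_natCast]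
  congr 1
  have : (b : ℝ) ≠ 0 := by positivity
  rw [pow_succ]
  field_simp

theorem block_succ (hb : 0 < b) (h j : ℕ) :
    block b x (h + 1) j = b * block b x h j + ⌊(b : ℝ) ^ (j + h + 1) * x⌋₊ % b := by
  unfold block
  rw [← floor_pow_succ_div hb (j + h), pow_succ', Nat.mod_mul, add_comm, ← add_assoc]

theorem block_succ_div (hb : 0 < b) (h j : ℕ) : block b x (h + 1) j / b = block b x h j := by
  rw [block_succ hb, Nat.mul_add_div hb, Nat.div_eq_of_lt (Nat.mod_lt _ hb), add_zero]

/-- If the frequencies of all blocks are nearly right, then so are those of intervals with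
`b`-adic endpoints. -/
theorem abs_card_block_lt_sub_le (hb : 0 < b) {k s n : ℕ} {E : ℕ → ℝ}
    (hE : ∀ h, 1 ≤ h → h ≤ k → ∀ v < b ^ h,
      |(((Finset.range n).filter fun j => block b x h (s + j) = v).card : ℝ) - n / b ^ h| ≤ E h) :
    ∀ h ≤ k, ∀ a ≤ b ^ h,
      |(((Finset.range n).filter fun j => block b x h (s + j) < a).card : ℝ) - n * (a / b ^ h)| ≤
        b * ∑ i ∈ Finset.Icc 1 h, E i := by
  intro h
  induction h with
  | zero =>
    intro _ a ha
    rw [pow_zero] at ha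
    have h0 : ∀ j, block b x 0 j = 0 := fun j => by
      have := block_lt (x := x) hb 0 j
      rw [pow_zero] at this
      omega
    interval_cases a
    · simp
    · simp [h0]
  | succ h ih =>
    intro hk a ha
    have hbR : (0 : ℝ) < b := by exact_mod_cast hb
    set a' := a / b with ha'
    set e := a % b with he
    have hae : b * a' + e = a := Nat.div_add_mod a b
    have heb : e < b := Nat.mod_lt _ hb
    have ha'b : a' ≤ b ^ h := by
      have : a' ≤ b ^ (h + 1) / b := Nat.div_le_div_right ha
      rwa [pow_succ, Nat.mul_div_cancel _ hb] at this
    -- With a = b·a' + e, a block is below a iff its prefix is below a' or it is one of the e < b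
    -- blocks b·a' + t. Each level thus costs at most b block errors.
    have hsplit : ((Finset.range n).filter fun j => block b x (h + 1) (s + j) < a).card =
        ((Finset.range n).filter fun j => block b x h (s + j) < a').card +
          ∑ t ∈ Finset.range e,
            ((Finset.range n).filter fun j => block b x (h + 1) (s + j) = b * a' + t).card := by
      simp only [Finset.card_filter]
      rw [Finset.sum_comm, ← Finset.sum_add_distrib]
      refine Finset.sum_congr rfl fun j _ => ?_
      rw [← block_succ_div hb h (s + j)]
      set y := block b x (h + 1) (s + j)
      have hy : b * (y / b) + y % b = y := Nat.div_add_mod y b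
      have hyb : y % b < b := Nat.mod_lt _ hb
      rcases lt_trichotomy (y / b) a' with hlt | heq | hgt
      · have h1 : b * (y / b + 1) ≤ b * a' := Nat.mul_le_mul_left b hlt
        rw [mul_add] at h1
        rw [if_pos (by omega), if_pos hlt, Finset.sum_eq_zero fun t _ => if_neg (by omega),
          add_zero]
      · rw [heq] at hy
        rw [if_neg (by omega : ¬y / b < a'), zero_add]
        have : ∀ t, (y = b * a' + t) = (y % b = t) := fun t => propext (by omega)
        simp only [this]
        rw [Finset.sum_ite_eq]
        by_cases hya : y < a
        · rw [if_pos hya, if_pos (Finset.mem_range.2 (by omega))]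
        · rw [if_neg hya, if_neg fun h' => hya (by have := Finset.mem_range.1 h'; omega)]
      · have h1 : b * (a' + 1) ≤ b * (y / b) := Nat.mul_le_mul_left b hgt
        rw [mul_add] at h1
        rw [if_neg (by omega), if_neg (by omega), zero_add, Finset.sum_eq_zero]
        intro t ht
        have := Finset.mem_range.1 ht
        rw [if_neg (by omega)]
    have hsum : |∑ t ∈ Finset.range e, (((((Finset.range n).filter fun j =>
        block b x (h + 1) (s + j) = b * a' + t).card : ℕ) : ℝ) - n / b ^ (h + 1))| ≤
        b * E (h + 1) := by
      have hE0 : 0 ≤ E (h + 1) :=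
        (abs_nonneg _).trans (hE (h + 1) (by omega) hk 0 (by positivity))
      refine (Finset.abs_sum_le_sum_abs _ _).trans ?_
      calc _ ≤ ∑ t ∈ Finset.range e, E (h + 1) := by
            refine Finset.sum_le_sum fun t ht => hE (h + 1) (by omega) hk _ ?_
            have := Finset.mem_range.1 ht
            omega
        _ = e * E (h + 1) := by simp
        _ ≤ b * E (h + 1) := by
            refine mul_le_mul_of_nonneg_right ?_ hE0
            exact_mod_cast heb.le
    have := ih (by omega) a' ha'b
    rw [hsplit, Finset.sum_Icc_succ_top (by omega), mul_add]
    have haR : (a : ℝ) = b * a' + e := by exact_mod_cast hae.symm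
    rw [Finset.sum_sub_distrib, Finset.sum_const, Finset.card_range, nsmul_eq_mul] at hsum
    push_cast
    have heq : (n : ℝ) * (a / b ^ (h + 1)) = n * (a' / b ^ h) + e * (n / b ^ (h + 1)) := by
      rw [haR, pow_succ]
      field_simp
    rw [heq]
    refine le_trans (le_of_eq ?_) ((abs_add_le _ _).trans (add_le_add this hsum))
    congr 1
    ring

/-- The same for intervals with arbitrary endpoints. -/
theorem abs_card_fract_lt_sub_le (hb : 0 < b) (hx : 0 ≤ x) {k s n : ℕ} {F : ℝ}
    (hF : ∀ a ≤ b ^ k,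
      |(((Finset.range n).filter fun j => block b x k (s + j) < a).card : ℝ) - n * (a / b ^ k)| ≤ F)
    {u : ℝ} (hu0 : 0 ≤ u) (hu1 : u ≤ 1) :
    |(((Finset.range n).filter fun j => Int.fract ((b : ℝ) ^ (s + j) * x) < u).card : ℝ) - n * u| ≤
      F + n / b ^ k := by
  have hB : (0 : ℝ) < (b : ℝ) ^ k := by positivity
  have hn : (0 : ℝ) ≤ n := Nat.cast_nonneg n
  -- The endpoint u is enclosed by a/b^k and (a+1)/b^k; the minimum with b^k below keeps the upper
  -- neighbour within [0, 1].
  set a := ⌊(b : ℝ) ^ k * u⌋₊ with ha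
  have ha1 : (a : ℝ) ≤ b ^ k * u := Nat.floor_le (by positivity)
  have ha2 : (b : ℝ) ^ k * u < a + 1 := Nat.lt_floor_add_one _
  have hab : a ≤ b ^ k := by
    refine Nat.floor_le_of_le ?_
    push_cast
    nlinarith
  have hlow : ((Finset.range n).filter fun j => block b x k (s + j) < a).card ≤
      ((Finset.range n).filter fun j => Int.fract ((b : ℝ) ^ (s + j) * x) < u).card := by
    refine Finset.card_le_card fun j hj => ?_
    obtain ⟨hj1, hj2⟩ := Finset.mem_filter.1 hj
    refine Finset.mem_filter.2 ⟨hj1, ?_⟩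
    rw [← floor_mul_fract hb hx, Nat.floor_lt (mul_nonneg hB.le (Int.fract_nonneg _))] at hj2
    exact lt_of_mul_lt_mul_left (hj2.trans_le ha1) hB.le
  have hupp : ((Finset.range n).filter fun j => Int.fract ((b : ℝ) ^ (s + j) * x) < u).card ≤
      ((Finset.range n).filter fun j => block b x k (s + j) < min (a + 1) (b ^ k)).card := by
    refine Finset.card_le_card fun j hj => ?_
    obtain ⟨hj1, hj2⟩ := Finset.mem_filter.1 hj
    refine Finset.mem_filter.2 ⟨hj1, lt_min ?_ (block_lt hb _ _)⟩
    rw [← floor_mul_fract hb hx, Nat.floor_lt (mul_nonneg hB.le (Int.fract_nonneg _))]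
    push_cast
    exact (mul_lt_mul_of_pos_left hj2 hB).trans ha2
  have h1 := abs_le.1 (hF a hab)
  have h2 := abs_le.1 (hF (min (a + 1) (b ^ k)) (min_le_right _ _))
  have hlowR := (Nat.cast_le (α := ℝ)).2 hlow
  have huppR := (Nat.cast_le (α := ℝ)).2 hupp
  have e1 : (n : ℝ) * u - n / b ^ k ≤ n * (a / b ^ k) := by
    rw [div_eq_mul_one_div, ← mul_sub]
    refine mul_le_mul_of_nonneg_left ?_ hn
    rw [le_div_iff₀ hB, sub_mul, one_div, inv_mul_cancel₀ hB.ne']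
    linarith
  have e2 : (n : ℝ) * ((min (a + 1) (b ^ k) : ℕ) / b ^ k) ≤ n * u + n / b ^ k := by
    rw [div_eq_mul_one_div (n : ℝ), ← mul_add]
    refine mul_le_mul_of_nonneg_left ?_ hn
    rw [div_le_iff₀ hB, add_mul, one_div, inv_mul_cancel₀ hB.ne']
    have : ((min (a + 1) (b ^ k) : ℕ) : ℝ) ≤ a + 1 := by exact_mod_cast min_le_left _ _
    linarith
  rw [abs_le]
  constructor <;> linarith [h1.1, h2.2]

end block

theorem sum_inv_sq_le (h : ℕ) : ∑ i ∈ Finset.Icc 1 h, 1 / (i : ℝ) ^ 2 ≤ 2 := by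
  suffices ∑ i ∈ Finset.Icc 1 h, 1 / (i : ℝ) ^ 2 ≤ 2 - 1 / (h : ℝ) by
    have : (0 : ℝ) ≤ 1 / (h : ℝ) := by positivity
    linarith
  induction h with
  | zero => simp
  | succ h ih =>
    rw [Finset.sum_Icc_succ_top (by omega)]
    rcases Nat.eq_zero_or_pos h with rfl | hh
    · norm_num
    · have hR : (0 : ℝ) < h := by exact_mod_cast hh
      have : 1 / ((h + 1 : ℕ) : ℝ) ^ 2 ≤ 1 / (h : ℝ) - 1 / ((h + 1 : ℕ) : ℝ) := by
        push_cast
        rw [div_sub_div _ _ hR.ne' (by positivity), div_le_div_iff₀ (by positivity) (by positivity)]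
        nlinarith
      linarith

/-! ### Deviations within a stage and across stages -/

namespace IsLimit

variable {K : ℕ} {x : ℝ}

/-- Each of the h residue classes contributes at most l·2^k/h³, which leaves 1/h², summable over the
block lengths. -/
theorem abs_card_block_sub_le (hx : IsLimit K x) (hK : GoodSubcells K) {b k n : ℕ} (hb : 2 ≤ b)
    (hbk : IsActive K b k) (hn : startPos (· ^ ·) b k + n + k ≤ endPos (· ^ ·) b k) {h : ℕ}
    (hh : 1 ≤ h) (hhk : h ≤ k) {v : ℕ} (hv : v < b ^ h) :
    |(((Finset.range n).filter fun j =>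
      block b x h (startPos (· ^ ·) b k + j) = v).card : ℝ) - n / b ^ h| ≤
      (logLog (· ^ ·) k * 2 ^ k) * (1 / h ^ 2) := by
  set s := startPos (· ^ ·) b k
  set L := endPos (· ^ ·) b k with hL
  set l := logLog (· ^ ·) k
  set M := 2 ^ 4 ^ (k + 1) with hM
  set A := cellSeq K (k + 1)
  let q : ℕ → ℕ := fun c => (n + h - 1 - c) / h
  let C : ℕ → ℕ := fun c => blockCount (b ^ ·) M A (s + c) h (q c) v
  have hLR : L ≤ 4 ^ (k + 1) := (Nat.sub_le _ _).trans (logCount_le _ _ _)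
  have hq : ∀ c < h, c + h * q c ≤ n + h - 1 := fun c hc => by
    have := Nat.mul_div_le (n + h - 1 - c) h
    change c + h * ((n + h - 1 - c) / h) ≤ _
    omega
  have hcount : ((Finset.range n).filter fun j => block b x h (s + j) = v).card =
      ∑ c ∈ Finset.range h, C c := by
    rw [Finset.card_filter, sum_range_eq_sum_classes (by omega : 0 < h)]
    refine Finset.sum_congr rfl fun c hc => ?_
    change _ = blockCount (b ^ ·) M A (s + c) h (q c) v
    unfold blockCount
    rw [Finset.card_filter]
    refine Finset.sum_congr rfl fun i hi => ?_
    have hi : i + 1 ≤ q c := Finset.mem_range.1 hi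
    have h1 := Nat.mul_le_mul_left h hi
    have h2 := hq c (Finset.mem_range.1 hc)
    unfold block
    rw [show s + (c + h * i) + h = s + c + h * (i + 1) by ring,
      hx.floor_eq hK hb hbk (by rw [← hL]; omega)]
  have hqsum : ∑ c ∈ Finset.range h, q c = n := by
    have := sum_range_eq_sum_classes (by omega : 0 < h) (fun _ => 1) n
    simp only [Finset.sum_const, Finset.card_range, smul_eq_mul, mul_one] at this
    exact this.symm
  have hBp : (0 : ℝ) < (b : ℝ) ^ h := by positivity
  have hhp : (0 : ℝ) < h := by exact_mod_cast hh
  have hterm : ∀ c ∈ Finset.range h, |(C c : ℝ) * b ^ h - q c| ≤ l * 2 ^ k * b ^ h / h ^ 3 := by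
    intro c hc
    have hc := Finset.mem_range.1 hc
    have h2 := hq c hc
    have h3 : q c ≤ h * q c := Nat.le_mul_of_pos_left _ (by omega)
    have h4 := (cellGood hK hb hbk).2 h (by omega) hh c hc (q c) (by omega) (by omega) v hv
    have h5 : |(C c : ℝ) * b ^ h - q c| = ((C c * b ^ h - q c + (q c - C c * b ^ h) : ℕ) : ℝ) := by
      rcases le_total (C c * b ^ h) (q c) with hle | hle
      · have : (C c : ℝ) * b ^ h ≤ q c := by exact_mod_cast hle
        rw [abs_of_nonpos (by linarith), Nat.sub_eq_zero_of_le hle, zero_add, Nat.cast_sub hle]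
        push_cast
        ring
      · have : (q c : ℝ) ≤ C c * b ^ h := by exact_mod_cast hle
        rw [abs_of_nonneg (by linarith), Nat.sub_eq_zero_of_le hle, add_zero, Nat.cast_sub hle]
        push_cast
        ring
    rw [h5, le_div_iff₀ (by positivity), show (h : ℝ) ^ 3 = ((h * h * h : ℕ) : ℝ) by
      push_cast; ring]
    exact_mod_cast h4
  have htot : |(∑ c ∈ Finset.range h, ((C c : ℝ) * b ^ h - q c))| ≤
      h * (l * 2 ^ k * b ^ h / h ^ 3) := by
    refine (Finset.abs_sum_le_sum_abs _ _).trans ((Finset.sum_le_sum hterm).trans ?_)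
    rw [Finset.sum_const, Finset.card_range, nsmul_eq_mul]
  rw [Finset.sum_sub_distrib, ← Finset.sum_mul] at htot
  have hn' : ∑ c ∈ Finset.range h, (q c : ℝ) = n := by exact_mod_cast hqsum
  rw [hn'] at htot
  rw [hcount]
  push_cast
  refine le_of_mul_le_mul_right (a := (b : ℝ) ^ h) ?_ hBp
  calc |(∑ c ∈ Finset.range h, (C c : ℝ)) - n / b ^ h| * b ^ h
      = |(∑ c ∈ Finset.range h, (C c : ℝ)) * b ^ h - n| := by
        conv_lhs => rw [← abs_of_pos hBp]
        rw [← abs_mul, sub_mul, abs_of_pos hBp, div_mul_cancel₀ _ hBp.ne']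
    _ ≤ h * (l * 2 ^ k * b ^ h / h ^ 3) := htot
    _ = _ := by field_simp

/-- The term 2·b·l is b·l times a bound for the sum of 1/h²; the 4 is the rounding error n/b^k ≤
4^(k+1)/2^k. -/
theorem abs_card_window_sub_le (hx : IsLimit K x) (hK : GoodSubcells K) {b k n : ℕ} (hb : 2 ≤ b)
    (hbk : IsActive K b k) (hn : startPos (· ^ ·) b k + n + k ≤ endPos (· ^ ·) b k)
    {u : ℝ} (hu0 : 0 ≤ u) (hu1 : u ≤ 1) :
    |(((Finset.range n).filter fun j =>
      Int.fract ((b : ℝ) ^ (startPos (· ^ ·) b k + j) * x) < u).card : ℝ) - n * u| ≤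
      (2 * b * logLog (· ^ ·) k + 4) * 2 ^ k := by
  have hb0 : 0 < b := by omega
  have h1 := abs_card_block_lt_sub_le (x := x) hb0 (k := k) (s := startPos (· ^ ·) b k) (n := n)
    (E := fun h => (logLog (· ^ ·) k * 2 ^ k) * (1 / (h : ℝ) ^ 2))
    fun h hh hhk v hv => hx.abs_card_block_sub_le hK hb hbk hn hh hhk hv
  refine (abs_card_fract_lt_sub_le hb0 hx.nonneg (h1 k le_rfl) hu0 hu1).trans ?_
  have hsum := sum_inv_sq_le k
  have hn4 : n ≤ 4 ^ (k + 1) := by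
    have : endPos (· ^ ·) b k ≤ 4 ^ (k + 1) := (Nat.sub_le _ _).trans (logCount_le _ _ _)
    omega
  have h2 : (n : ℝ) / b ^ k ≤ 4 * 2 ^ k := by
    have hbk2 : (2 : ℝ) ^ k ≤ (b : ℝ) ^ k :=
      pow_le_pow_left₀ (by norm_num) (by exact_mod_cast hb) k
    have hp : (0 : ℝ) < 2 ^ k := by positivity
    rw [div_le_iff₀ (by positivity)]
    have hn4' : (n : ℝ) ≤ 4 ^ (k + 1) := by exact_mod_cast hn4
    have h44 : (4 : ℝ) ^ (k + 1) = 4 * (2 ^ k * 2 ^ k) := by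
      rw [← mul_pow, pow_succ]
      norm_num
      ring
    nlinarith [mul_le_mul_of_nonneg_left hbk2 hp.le]
  have h3 : (b : ℝ) * ∑ i ∈ Finset.Icc 1 k, (logLog (· ^ ·) k * 2 ^ k) * (1 / (i : ℝ) ^ 2) ≤
      2 * b * logLog (· ^ ·) k * 2 ^ k := by
    rw [← Finset.mul_sum]
    calc _ ≤ (b : ℝ) * ((logLog (· ^ ·) k * 2 ^ k) * 2) := by gcongr
      _ = _ := by ring
  linarith

/-- The deviation of the number of the first `N` terms below `u` from its expectation. -/
noncomputable def _root_.starDev (b : ℕ) (x : ℝ) (N : ℕ) (u : ℝ) : ℝ :=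
  (((Finset.range N).filter fun j => Int.fract ((b : ℝ) ^ j * x) < u).card : ℝ) - N * u

theorem _root_.starDev_add (b : ℕ) (x : ℝ) (N n : ℕ) (u : ℝ) : starDev b x (N + n) u =
    starDev b x N u + ((((Finset.range n).filter fun j =>
      Int.fract ((b : ℝ) ^ (N + j) * x) < u).card : ℝ) - n * u) := by
  unfold starDev
  have : ((Finset.range (N + n)).filter fun j => Int.fract ((b : ℝ) ^ j * x) < u).card =
      ((Finset.range N).filter fun j => Int.fract ((b : ℝ) ^ j * x) < u).card +
      ((Finset.range n).filter fun j => Int.fract ((b : ℝ) ^ (N + j) * x) < u).card := by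
    simp only [Finset.card_filter]
    rw [Finset.sum_range_add]
  rw [this]
  push_cast
  ring

theorem _root_.abs_card_filter_sub_le (n : ℕ) (P : ℕ → Prop) [DecidablePred P] {u : ℝ}
    (hu0 : 0 ≤ u) (hu1 : u ≤ 1) : |(((Finset.range n).filter P).card : ℝ) - n * u| ≤ n := by
  have h1 : (((Finset.range n).filter P).card : ℝ) ≤ n := by
    exact_mod_cast (Finset.card_filter_le _ _).trans (Finset.card_range n).le
  have h2 : (0 : ℝ) ≤ ((Finset.range n).filter P).card := Nat.cast_nonneg _
  have h3 : (n : ℝ) * u ≤ n := mul_le_of_le_one_right (Nat.cast_nonneg n) hu1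
  have h4 : 0 ≤ (n : ℝ) * u := by positivity
  rw [abs_le]
  constructor <;> linarith

/-- The tests miss at most 2k + 1 ≤ 3·2^k positions between consecutive starts. These are estimated
trivially, which raises the 4 to 7. -/
theorem abs_starDev_sub_le (hx : IsLimit K x) (hK : GoodSubcells K) {b k N : ℕ} (hb : 2 ≤ b)
    (hbk : IsActive K b k) (hN : startPos (· ^ ·) b k ≤ N)
    (hN' : N ≤ startPos (· ^ ·) b (k + 1)) {u : ℝ} (hu0 : 0 ≤ u) (hu1 : u ≤ 1) :
    |starDev b x N u - starDev b x (startPos (· ^ ·) b k) u| ≤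
      (2 * b * logLog (· ^ ·) k + 7) * 2 ^ k := by
  obtain ⟨n, rfl⟩ := Nat.exists_eq_add_of_le hN
  have hs' : startPos (· ^ ·) b (k + 1) = endPos (· ^ ·) b k + k + 1 ∨
      endPos (· ^ ·) b k = 0 ∧ startPos (· ^ ·) b (k + 1) ≤ k + 1 := by
    rw [startPos_eq hb, endPos_eq hb]
    omega
  set s := startPos (· ^ ·) b k with hs
  set n₁ := min n (endPos (· ^ ·) b k - k - s) with hn₁
  obtain ⟨m, hm⟩ := Nat.exists_eq_add_of_le (min_le_left n (endPos (· ^ ·) b k - k - s))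
  rw [← hn₁] at hm
  have hmk : m ≤ 2 * k + 1 := by omega
  have h2k : (2 * k + 1 : ℝ) ≤ 3 * 2 ^ k := by
    have h : k < 2 ^ k := Nat.lt_two_pow_self
    exact_mod_cast (by omega : 2 * k + 1 ≤ 3 * 2 ^ k)
  have hmR : (m : ℝ) ≤ 2 * k + 1 := by exact_mod_cast hmk
  have hbl : (0 : ℝ) ≤ (2 * b * logLog (· ^ ·) k + 4) * 2 ^ k := by positivity
  have hwin : |(((Finset.range n₁).filter fun j =>
      Int.fract ((b : ℝ) ^ (s + j) * x) < u).card : ℝ) - n₁ * u| ≤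
      (2 * b * logLog (· ^ ·) k + 4) * 2 ^ k := by
    rcases Nat.eq_zero_or_pos n₁ with h0 | h0
    · rw [h0]
      simpa using hbl
    · exact hx.abs_card_window_sub_le hK hb hbk (by omega) hu0 hu1
  rw [hm, ← add_assoc, starDev_add, starDev_add]
  have hrest := abs_card_filter_sub_le m
    (fun j => Int.fract ((b : ℝ) ^ (s + n₁ + j) * x) < u) hu0 hu1
  rw [abs_le] at hwin hrest ⊢
  constructor <;> linarith [hwin.1, hwin.2, hrest.1, hrest.2]

theorem _root_.logLog_mono : Monotone (logLog (· ^ ·)) := fun i j h => by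
  rw [logLog_eq, logLog_eq]
  exact Nat.log_mono_right (Nat.log_mono_right h)

theorem _root_.startPos_mono {b : ℕ} (hb : 2 ≤ b) : Monotone (startPos (· ^ ·) b) :=
  fun i j h => by
  rw [startPos_eq hb, startPos_eq hb]
  exact Nat.succ_le_succ (Nat.log_mono_right (Nat.pow_le_pow_right (by norm_num)
    (Nat.pow_le_pow_right (by norm_num) h)))

/-- The errors of the stages are dominated by a geometric series, so the earlier stages together
cost no more than the current one; the digits before stage k₀ are counted trivially. -/
theorem abs_starDev_le (hx : IsLimit K x) (hK : GoodSubcells K) {b k₀ : ℕ} (hb : 2 ≤ b)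
    (hact : ∀ k ≥ k₀, IsActive K b k) {u : ℝ} (hu0 : 0 ≤ u) (hu1 : u ≤ 1) {k N : ℕ}
    (hk : k₀ ≤ k) (hN : startPos (· ^ ·) b k ≤ N) (hN' : N ≤ startPos (· ^ ·) b (k + 1)) :
    |starDev b x N u| ≤
      startPos (· ^ ·) b k₀ + (2 * b * logLog (· ^ ·) k + 7) * (2 * 2 ^ k) := by
  have hstart : |starDev b x (startPos (· ^ ·) b k) u| ≤
      startPos (· ^ ·) b k₀ + (2 * b * logLog (· ^ ·) k + 7) * 2 ^ k := by
    clear hN hN'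
    induction k, hk using Nat.le_induction with
    | base =>
      refine (abs_card_filter_sub_le _ _ hu0 hu1).trans (le_add_of_nonneg_right (by positivity))
    | succ k hk ih =>
      have h := hx.abs_starDev_sub_le hK hb (hact k hk) (startPos_mono hb (Nat.le_succ k)) le_rfl
        hu0 hu1
      have hl : (logLog (· ^ ·) k : ℝ) ≤ logLog (· ^ ·) (k + 1) := by
        exact_mod_cast logLog_mono (Nat.le_succ k)
      have h2 : (2 * b * logLog (· ^ ·) k + 7 : ℝ) * 2 ^ k ≤
          (2 * b * logLog (· ^ ·) (k + 1) + 7) * 2 ^ k := by gcongr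
      rw [pow_succ]
      rw [abs_le] at h ih ⊢
      constructor <;> linarith [h.1, h.2, ih.1, ih.2]
  have h := hx.abs_starDev_sub_le hK hb (hact k hk) hN hN' hu0 hu1
  rw [abs_le] at h hstart ⊢
  constructor <;> linarith [h.1, h.2, hstart.1, hstart.2]

end IsLimit

/-! ### From one-sided deviations to the discrepancy -/

theorem card_subtype_eq (N : ℕ) (P : ℕ → Prop) [DecidablePred P] :
    Nat.card {j : ℕ // j < N ∧ P j} = ((Finset.range N).filter P).card :=
  Nat.subtype_card _ fun j => by simp

theorem card_interval_eq (b : ℕ) (x : ℝ) (N : ℕ) {u v : ℝ} (huv : u ≤ v) :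
    (Nat.card {j : ℕ // j < N ∧ u ≤ Int.fract ((b : ℝ) ^ j * x) ∧
      Int.fract ((b : ℝ) ^ j * x) < v} : ℝ) - N * (v - u) = starDev b x N v - starDev b x N u := by
  have h : ((Finset.range N).filter fun j => Int.fract ((b : ℝ) ^ j * x) < v).card =
      ((Finset.range N).filter fun j => Int.fract ((b : ℝ) ^ j * x) < u).card +
      ((Finset.range N).filter fun j => u ≤ Int.fract ((b : ℝ) ^ j * x) ∧
        Int.fract ((b : ℝ) ^ j * x) < v).card := by
    simp only [Finset.card_filter]
    rw [← Finset.sum_add_distrib]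
    refine Finset.sum_congr rfl fun j _ => ?_
    rcases lt_or_ge (Int.fract ((b : ℝ) ^ j * x)) u with hlt | hge
    · simp [hlt, hlt.trans_le huv, not_le.2 hlt]
    · simp [hge, not_lt.2 hge]
  rw [card_subtype_eq, starDev, starDev, h]
  push_cast
  ring

theorem discrepancy_le {b : ℕ} {x : ℝ} {N : ℕ} (hN : 0 < N) {E : ℝ}
    (hE : ∀ u, 0 ≤ u → u ≤ 1 → |starDev b x N u| ≤ E) :
    discrepancy N (fun j => Int.fract ((b : ℝ) ^ j * x)) ≤ 2 * E / N := by
  have hNR : (0 : ℝ) < N := by exact_mod_cast hN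
  refine csSup_le ⟨_, 0, 1, le_rfl, zero_lt_one, le_rfl, rfl⟩ ?_
  rintro _ ⟨u, v, hu, huv, hv, rfl⟩
  have h1 := abs_le.1 (hE u hu (huv.le.trans hv))
  have h2 := abs_le.1 (hE v (hu.trans huv.le) hv)
  rw [div_sub' hNR.ne', card_interval_eq b x N huv.le, abs_div, abs_of_pos hNR]
  refine div_le_div_of_nonneg_right ?_ hNR.le
  rw [abs_le]
  constructor <;> linarith [h1.1, h1.2, h2.1, h2.2]

/-! ### The law of the iterated logarithm and normality -/

theorem four_pow_le_mul_startPos {b : ℕ} (hb : 2 ≤ b) (k : ℕ) :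
    4 ^ k ≤ b * startPos (· ^ ·) b k := by
  have h1 : b ^ startPos (· ^ ·) b k ≤ (2 ^ b) ^ startPos (· ^ ·) b k :=
    Nat.pow_le_pow_left Nat.lt_two_pow_self.le _
  rw [← pow_mul] at h1
  exact (Nat.pow_le_pow_iff_right (by norm_num)).1 ((two_pow_le_pow_startPos hb k).trans h1)

theorem exists_startPos_le {b : ℕ} (hb : 2 ≤ b) {k₀ N : ℕ} (hN : startPos (· ^ ·) b k₀ ≤ N) :
    ∃ k ≥ k₀, startPos (· ^ ·) b k ≤ N ∧ N ≤ startPos (· ^ ·) b (k + 1) := by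
  have hex : ∃ m, N < startPos (· ^ ·) b (k₀ + m + 1) := by
    refine ⟨b * N, ?_⟩
    have h1 := four_pow_le_mul_startPos hb (k₀ + b * N + 1)
    have h2 : k₀ + b * N + 1 < 4 ^ (k₀ + b * N + 1) := Nat.lt_pow_self (by norm_num)
    exact lt_of_mul_lt_mul_left (a := b) (by omega) (Nat.zero_le b)
  refine ⟨k₀ + Nat.find hex, Nat.le_add_right _ _, ?_, (Nat.find_spec hex).le⟩
  rcases Nat.eq_zero_or_pos (Nat.find hex) with h | h
  · rwa [h]
  · have := Nat.find_min hex (m := Nat.find hex - 1) (by omega)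
    rw [show k₀ + (Nat.find hex - 1) + 1 = k₀ + Nat.find hex by omega] at this
    exact not_lt.1 this

/-- From b ≤ k ≤ 2^k follows N ≥ 2^k, so log N ≥ k/2 ≥ 2^p/2 with p = ⌊log₂ k⌋. Hence log log N ≥ (p
- 1)/2 ≥ p/4 ≥ 2^l/4. -/
theorem two_pow_logLog_le {b k N : ℕ} (hbk : b ≤ k) (hk : 1 ≤ logLog (· ^ ·) k)
    (hN : 4 ^ k ≤ b * N) :
    (2 : ℝ) ^ logLog (· ^ ·) k / 4 ≤ Real.log (Real.log N) := by
  rw [logLog_eq] at hk ⊢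
  set p := Nat.log 2 k with hp
  set l := Nat.log 2 p with hl
  have hp0 : p ≠ 0 := by
    rintro h
    rw [hl, h] at hk
    simp at hk
  have hk0 : k ≠ 0 := by
    rintro h
    rw [hp, h] at hp0
    simp at hp0
  have hlp : (2 : ℝ) ^ l ≤ p := by exact_mod_cast Nat.pow_log_le_self 2 hp0
  have hpk : (2 : ℝ) ^ p ≤ k := by exact_mod_cast Nat.pow_log_le_self 2 hk0
  have h2N : 2 ^ k ≤ N := by
    have h1 : b ≤ 2 ^ k := hbk.trans Nat.lt_two_pow_self.le
    have h2 : 2 ^ k * 2 ^ k ≤ 2 ^ k * N := by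
      rw [← mul_pow]
      exact hN.trans (Nat.mul_le_mul_right N h1)
    exact Nat.le_of_mul_le_mul_left h2 (by positivity)
  have hlog2 : (1 : ℝ) / 2 ≤ Real.log 2 := by linarith [Real.log_two_gt_d9]
  have hlogN : (2 : ℝ) ^ p * 2⁻¹ ≤ Real.log N := by
    have h1 : Real.log ((2 : ℝ) ^ k) ≤ Real.log N :=
      Real.log_le_log (by positivity) (by exact_mod_cast h2N)
    rw [Real.log_pow] at h1
    have h2 : (k : ℝ) * (1 / 2) ≤ k * Real.log 2 := by gcongr
    linarith
  have hloglog := Real.log_le_log (by positivity) hlogN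
  rw [Real.log_mul (by positivity) (by positivity), Real.log_pow, Real.log_inv] at hloglog
  have hp2 : (2 : ℝ) ≤ p := by
    have : (2 : ℝ) ^ 1 ≤ 2 ^ l := pow_le_pow_right₀ (by norm_num) hk
    linarith
  have h3 : ((p : ℝ) - 1) * (1 / 2) ≤ (p - 1) * Real.log 2 :=
    mul_le_mul_of_nonneg_left hlog2 (by linarith)
  linarith

theorem eventually_mul_logLog_le (C : ℝ) (b : ℕ) : ∀ᶠ k in atTop, ∀ N : ℕ, 4 ^ k ≤ b * N →
    0 < Real.sqrt (Real.log (Real.log N)) ∧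
      C * (1 + logLog (· ^ ·) k) ≤ Real.sqrt (Real.log (Real.log N)) := by
  have hlim : Tendsto (fun l : ℕ => (l : ℝ) ^ 2 / 2 ^ l) atTop (𝓝 0) :=
    tendsto_pow_const_div_const_pow_of_one_lt 2 (by norm_num)
  -- The threshold yields 16·C²·l² ≤ 2^l, hence C²·(1 + l)² ≤ 4·C²·l² ≤ 2^l/4.
  have hev := hlim.eventually_lt_const (show (0 : ℝ) < 1 / (16 * C ^ 2 + 1) by positivity)
  filter_upwards [tendsto_logLog.eventually hev, tendsto_logLog.eventually_ge_atTop 1,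
    eventually_ge_atTop b] with k hk hk1 hkb N hN
  have h := two_pow_logLog_le hkb hk1 hN
  set l := logLog (· ^ ·) k
  have hl1 : (1 : ℝ) ≤ l := by exact_mod_cast hk1
  have h2l : (0 : ℝ) < 2 ^ l := by positivity
  rw [div_lt_div_iff₀ h2l (by positivity)] at hk
  refine ⟨Real.sqrt_pos.2 (by linarith), Real.le_sqrt_of_sq_le (le_trans ?_ h)⟩
  have h1 : (1 + (l : ℝ)) ^ 2 ≤ 4 * l ^ 2 := by nlinarith
  have h2 : C ^ 2 * (1 + (l : ℝ)) ^ 2 ≤ C ^ 2 * (4 * l ^ 2) :=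
    mul_le_mul_of_nonneg_left h1 (sq_nonneg C)
  rw [mul_pow]
  nlinarith [sq_nonneg (l : ℝ)]

/-- Along the limit of the construction, the discrepancy is of smaller order than the law of the
iterated logarithm requires. -/
theorem IsLimit.eventually_discrepancy_le {K : ℕ} {x : ℝ} (hx : IsLimit K x)
    (hK : GoodSubcells K) {b : ℕ} (hb : 2 ≤ b) : ∀ᶠ N : ℕ in atTop,
    0 < Real.sqrt (Real.log (Real.log N)) ∧
      discrepancy N (fun j => Int.fract ((b : ℝ) ^ j * x)) * Real.sqrt N ≤
        Real.sqrt (Real.log (Real.log N)) := by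
  obtain ⟨k₀, hact⟩ := eventually_atTop.1 (eventually_isActive K b)
  set S : ℝ := ((startPos (· ^ ·) b k₀ : ℕ) : ℝ) with hS
  -- The final bound is 2·(S + (2bl + 7)·2b) = 2S + 28b + 8b²l.
  set C : ℝ := 2 * S + 28 * b + 8 * b ^ 2 with hC
  obtain ⟨k₁, hk₁⟩ := eventually_atTop.1 (eventually_mul_logLog_le C b)
  filter_upwards [eventually_ge_atTop (startPos (· ^ ·) b (max k₀ k₁)), eventually_gt_atTop 0]
    with N hN hN0
  obtain ⟨k, hk, hkN, hkN'⟩ := exists_startPos_le hb hN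
  have h4 : 4 ^ k ≤ b * N := (four_pow_le_mul_startPos hb k).trans (Nat.mul_le_mul_left b hkN)
  obtain ⟨hpos, hle⟩ := hk₁ k ((le_max_right _ _).trans hk) N h4
  refine ⟨hpos, le_trans ?_ hle⟩
  set l := logLog (· ^ ·) k
  have hNR : (0 : ℝ) < N := by exact_mod_cast hN0
  have hbR : (1 : ℝ) ≤ b := by exact_mod_cast (by omega : 1 ≤ b)
  set r := Real.sqrt N with hr
  have hrr : r * r = N := Real.mul_self_sqrt hNR.le
  have hr1 : 1 ≤ r := Real.one_le_sqrt.2 (by exact_mod_cast hN0)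
  have h2k : (2 : ℝ) ^ k ≤ b * r := by
    have h4R : ((2 : ℝ) ^ k) ^ 2 ≤ b * N := by
      rw [← pow_mul, mul_comm, pow_mul]
      norm_num
      exact_mod_cast h4
    refine le_of_sq_le_sq (h4R.trans ?_) (by positivity)
    rw [mul_pow, sq r, hrr]
    nlinarith
  have hdisc := discrepancy_le (b := b) (x := x) hN0 fun u hu0 hu1 =>
    hx.abs_starDev_le hK hb hact hu0 hu1 ((le_max_left _ _).trans hk) hkN hkN'
  have hS0 : 0 ≤ S := by rw [hS]; positivity
  have hE : S + (2 * b * l + 7) * (2 * 2 ^ k) ≤ r * (S + (2 * b * l + 7) * (2 * b)) := by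
    have h1 : S ≤ r * S := le_mul_of_one_le_left hS0 hr1
    have h2 : (2 * b * l + 7 : ℝ) * (2 * 2 ^ k) ≤ (2 * b * l + 7) * (2 * (b * r)) := by gcongr
    linarith
  calc _ ≤ 2 * (S + (2 * b * l + 7) * (2 * 2 ^ k)) / N * r := by gcongr
    _ ≤ 2 * (r * (S + (2 * b * l + 7) * (2 * b))) / N * r := by gcongr
    _ = 2 * (S + (2 * b * l + 7) * (2 * b)) := by
        rw [← hrr]
        field_simp
    _ ≤ C * (1 + l) := by
        rw [hC]
        have : 0 ≤ S * l := by positivity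
        have : (0 : ℝ) ≤ b * l := by positivity
        have : (0 : ℝ) ≤ (b : ℝ) ^ 2 := by positivity
        nlinarith

/-- The quotient is eventually at most 1, and `philippConstant b` exceeds 166. -/
theorem IsLimit.limsup_lt {K : ℕ} {x : ℝ} (hx : IsLimit K x) (hK : GoodSubcells K) {b : ℕ}
    (hb : 2 ≤ b) :
    limsup (fun N : ℕ =>
      ((discrepancy N (fun j => Int.fract ((b : ℝ) ^ j * x)) * Real.sqrt N /
        Real.sqrt (Real.log (Real.log N)) : ℝ) : EReal)) atTop
      < ((3 * philippConstant b : ℝ) : EReal) := by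
  have h1 : (1 : ℝ) < 3 * philippConstant b := by
    have hs : 1 < Real.sqrt b := by
      rw [Real.lt_sqrt zero_le_one, one_pow]
      exact_mod_cast (by omega : 1 < b)
    have : 0 < 664 / (Real.sqrt b - 1) := div_pos (by norm_num) (by linarith)
    unfold philippConstant
    linarith
  refine lt_of_le_of_lt ?_ (EReal.coe_lt_coe_iff.2 h1)
  refine limsup_le_of_le (by isBoundedDefault) ?_
  filter_upwards [hx.eventually_discrepancy_le hK hb] with N hN
  exact EReal.coe_le_coe_iff.2 ((div_le_one hN.1).2 hN.2)

/-! ### Normality from vanishing discrepancy -/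

theorem abs_freq_sub_le_discrepancy (N : ℕ) (y : ℕ → ℝ) {u v : ℝ} (hu : 0 ≤ u) (huv : u < v)
    (hv : v ≤ 1) :
    |(Nat.card {j : ℕ // j < N ∧ u ≤ y j ∧ y j < v} : ℝ) / N - (v - u)| ≤ discrepancy N y := by
  classical
  refine le_csSup ⟨2, ?_⟩ ⟨u, v, hu, huv, hv, rfl⟩
  rintro _ ⟨u, v, hu, huv, hv, rfl⟩
  have h0 : (0 : ℝ) ≤ (Nat.card {j : ℕ // j < N ∧ u ≤ y j ∧ y j < v} : ℝ) / N := by positivity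
  have h1 : (Nat.card {j : ℕ // j < N ∧ u ≤ y j ∧ y j < v} : ℝ) / N ≤ 1 := by
    refine div_le_one_of_le₀ ?_ (Nat.cast_nonneg N)
    rw [card_subtype_eq]
    exact_mod_cast (Finset.card_filter_le _ _).trans (Finset.card_range N).le
  rw [abs_le]
  constructor <;> linarith

theorem exists_block_iff {b : ℕ} [NeZero b] {x : ℝ} (hx0 : 0 ≤ x) (hx1 : x < 1) {k : ℕ}
    (w : Fin k → Fin b) : ∃ a < b ^ k, ∀ j,
      (∀ i : Fin k, Real.digits (Int.fract x) b (j + i) = w i) ↔ block b x k j = a := by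
  have hb : 0 < b := Nat.pos_of_ne_zero (NeZero.ne b)
  induction k with
  | zero => exact ⟨0, by simp, fun j => by simp [block, Nat.mod_one]⟩
  | succ k ih =>
    obtain ⟨a, ha, h⟩ := ih fun i => w i.castSucc
    refine ⟨b * a + w (Fin.last k), ?_, fun j => ?_⟩
    · have h1 := (w (Fin.last k)).isLt
      calc b * a + w (Fin.last k) < b * (a + 1) := by rw [mul_add]; omega
        _ ≤ b * b ^ k := Nat.mul_le_mul_left b ha
        _ = _ := by rw [pow_succ']
    · have hd : Real.digits (Int.fract x) b (j + k) = w (Fin.last k) ↔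
          ⌊(b : ℝ) ^ (j + k + 1) * x⌋₊ % b = w (Fin.last k) := by
        rw [Fin.ext_iff, Int.fract_eq_self.2 ⟨hx0, hx1⟩, mul_comm]
        rfl
      rw [Fin.forall_fin_succ', block_succ hb]
      simp only [Fin.val_castSucc, Fin.val_last]
      rw [h j, hd]
      have h1 := (w (Fin.last k)).isLt
      have h2 := Nat.mod_lt ⌊(b : ℝ) ^ (j + k + 1) * x⌋₊ hb
      constructor
      · rintro ⟨e1, e2⟩
        rw [e1, e2]
      · intro e
        have e1 := congrArg (· / b) e
        simp only [Nat.mul_add_div hb, Nat.div_eq_of_lt h1, Nat.div_eq_of_lt h2, add_zero] at e1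
        refine ⟨e1, ?_⟩
        rw [e1] at e
        omega

theorem IsLimit.isNormalToBase {K : ℕ} {x : ℝ} (hx : IsLimit K x) (hK : GoodSubcells K) {b : ℕ}
    [NeZero b] (hb : 2 ≤ b) : IsNormalToBase b x := by
  intro k w
  obtain ⟨a, ha, haw⟩ := exists_block_iff hx.nonneg (hx.lt_one hK) w
  have hB : (0 : ℝ) < (b : ℝ) ^ k := by positivity
  have hcard : ∀ N : ℕ, Nat.card {j : ℕ // j < N ∧
      ∀ i : Fin k, Real.digits (Int.fract x) b (j + i) = w i} =
      Nat.card {j : ℕ // j < N ∧ (a : ℝ) / b ^ k ≤ Int.fract ((b : ℝ) ^ j * x) ∧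
        Int.fract ((b : ℝ) ^ j * x) < (a + 1) / b ^ k} := by
    intro N
    refine congrArg (fun P : ℕ → Prop => Nat.card {j : ℕ // P j}) (funext fun j => ?_)
    rw [haw, ← floor_mul_fract (by omega) hx.nonneg,
      Nat.floor_eq_iff (mul_nonneg hB.le (Int.fract_nonneg _)), div_le_iff₀ hB, lt_div_iff₀ hB,
      mul_comm]
  -- The discrepancy is eventually at most √(log log N / N), and log log N ≤ log N.
  have hlim : Tendsto (fun N : ℕ => Real.sqrt (Real.log N / N)) atTop (𝓝 0) := by
    have h1 : Tendsto (fun y : ℝ => Real.log y / y) atTop (𝓝 0) :=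
      Real.isLittleO_log_id_atTop.tendsto_div_nhds_zero
    have h2 := (Real.continuous_sqrt.tendsto 0).comp (h1.comp tendsto_natCast_atTop_atTop)
    rwa [Real.sqrt_zero] at h2
  rw [tendsto_iff_dist_tendsto_zero]
  refine squeeze_zero' (Eventually.of_forall fun _ => dist_nonneg) ?_ hlim
  filter_upwards [hx.eventually_discrepancy_le hK hb, eventually_gt_atTop 0] with N hN hN0
  have hNR : (0 : ℝ) < N := by exact_mod_cast hN0
  have hN1 : (1 : ℝ) ≤ N := by exact_mod_cast hN0
  have h1 := abs_freq_sub_le_discrepancy N (fun j => Int.fract ((b : ℝ) ^ j * x))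
    (u := (a : ℝ) / b ^ k) (v := (a + 1) / b ^ k) (by positivity) (by gcongr; linarith)
    (by
      rw [div_le_one hB]
      exact_mod_cast ha)
  rw [← sub_div, add_sub_cancel_left] at h1
  rw [Real.dist_eq, hcard]
  refine h1.trans ?_
  rw [Real.sqrt_div' _ hNR.le, le_div_iff₀ (Real.sqrt_pos.2 hNR)]
  exact hN.2.trans (Real.sqrt_le_sqrt (Real.log_le_self (Real.log_nonneg hN1)))

/-- The upper limit is taken in the extended reals, so that the bound includes its finiteness. -/
theorem theorem1 :
    ∃ x : ℝ, 0 ≤ x ∧ x < 1 ∧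
      IsAbsolutelyNormal x ∧
      (∀ b : ℕ, 2 ≤ b →
        limsup (fun N : ℕ =>
          ((discrepancy N (fun j => Int.fract ((b : ℝ) ^ j * x)) * Real.sqrt N /
            Real.sqrt (Real.log (Real.log N)) : ℝ) : EReal)) atTop
          < ((3 * philippConstant b : ℝ) : EReal)) ∧
      ∃ (p : Prog) (c : ℕ),
        p.ComputesBinaryDigitsInTime x (fun n => 2 ^ 2 ^ 2 ^ (c * n)) := by
  obtain ⟨K, hK⟩ := exists_stageGood
  replace hK : GoodSubcells K := hK
  obtain ⟨x, hx⟩ := hK.exists_limit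
  replace hx : IsLimit K x := hx
  refine ⟨x, hx.nonneg, hx.lt_one hK, fun b _ hb => hx.isNormalToBase hK hb,
    fun b hb => hx.limsup_lt hK hb, ?_⟩
  obtain ⟨p, c, h⟩ := exists_prog_of_comp
    (D := fun n V => stageDigit (cappedPow V) V K n)
    (Comp.stageDigit K (Comp.reg (by norm_num)) (Comp.reg (by norm_num)))
  refine ⟨p, c, fun n => ?_⟩
  obtain ⟨t, ht, hout⟩ := h n
  refine ⟨t, ht, hout.trans (List.map_congr_left fun i _ => ?_)⟩
  rw [hx.digits_eq hK, stageDigit_cappedPow]
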